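/- For $1<p<\infty$ let $$K_p=\left\{\begin{pmatrix}\lambda&0\\0&\lambda^{p-1}\end{pmatrix}R:\ \lambda\ge 0,\ R\in SO(2)\right\}\subset\mathbb R^{2\times 2}.$$ A \emph{regular domain} $\Omega\subset\mathbb R^2$ is a nonempty, open, bounded, connected set whose boundary has Lebesgue measure zero. A map $u\in W^{1,1}(\Omega;\mathbb R^2)$ is \emph{piecewise affine} if, up to a null set, $\Omega$ is an at most countable disjoint union of regular domains on each of which $u$ agrees with an affine map. For a matrix $X$, $|X|$ is the Euclidean (Frobenius) norm; row $i$ of $\nabla u$ is the (weak) gradient of $u_i$; and $\|f\|_{C^\alpha(\overline\Omega)}=\sup_{\overline\Omega}|f|+\sup_{x\ne y}|f(x)-f(y)|/|x-y|^\alpha$. \textbf{Theorem.} For every $1<p<2$ there exist $\bar q_p\in(1,p)$ and $M>1$, depending only on $p$, with the following property. For all $A\in\mathbb R^{2\times 2}$, $b\in\mathbb R^2$, $\alpha,\delta\in(0,1)$ and every regular domain $\Omega\subset\mathbb R^2$ there exists a piecewise affine map $u\in W^{1,1}(\Omega;\mathbb R^2)\cap C^\alpha(\overline\Omega;\mathbb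 R^2)$ such that (i) $u(x)=Ax+b$ for $x\in\partial\Omega$; (ii) $\|u-(Ax+b)\|_{C^\alpha(\overline\Omega)}<\delta$; (iii) $\nabla u(x)\in K_p$ for almost every $x\in\Omega$; (iv) for every $t>1+|A|$, $$M^{-1}\bigl(1+|A|^{(p-1)\bar q_p}\bigr)t^{-\bar q_p}\ \le\ \frac{|\{x\in\Omega:|\nabla u(x)|>t\}|}{|\Omega|}\ \le\ M\bigl(1+|A|^{\frac{\bar q_p}{p-1}}\bigr)t^{-\bar q_p};$$ (v) $u\in W^{1,q}(\Omega;\mathbb R^2)$ for every $1\le q<\bar q_p$, but $\int_\Omega|\nabla u|^{\bar q_p}\,dx=\infty$; (vi) the first component $v=u_1$ is a very weak solution of the $p$-Laplace equation: $|\nabla v|^{p-2}\nabla v$ (understood as $0$ where $\nabla v=0$) is locally integrable in $\Omega$ and $\operatorname{div}\bigl(|\nabla v|^{p-2}\nabla v\bigr)=0$ in $\Omega$ in the sense of distributions, while $\int_\Omega|\nabla v|^{\bar q_p}\,dx=\infty$. -/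

import Mathlib

open MeasureTheory Set
open scoped ENNReal NNReal ContDiff Matrix Matrix.Norms.Frobenius

/- Throughout, `‖X‖` for a matrix `X` is the Frobenius (Euclidean) norm. -/

namespace PLaplace

/-- The Euclidean plane. -/
abbrev Plane : Type := EuclideanSpace ℝ (Fin 2)

/-- Real `2 × 2` matrices. -/
abbrev Mat : Type := Matrix (Fin 2) (Fin 2) ℝ

/-- A regular domain: open, bounded, connected (in particular nonempty), with Lebesgue-null
boundary. -/
structure IsRegularDomain (Ω : Set Plane) : Prop where
  isOpen : IsOpen Ω
  isBounded : Bornology.IsBounded Ω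
  isConnected : IsConnected Ω
  volume_frontier : volume (frontier Ω) = 0

/-- The affine map `x ↦ A x + b`. -/
noncomputable def affineMap (A : Mat) (b : Plane) (x : Plane) : Plane :=
  Matrix.toEuclideanLin A x + b

/-- The set of matrices `diag(l, l ^ (p - 1)) R` with `l ≥ 0` and `R ∈ SO(2)`. -/
def K (p : ℝ) : Set Mat :=
  {X | ∃ l : ℝ, 0 ≤ l ∧ ∃ R ∈ Matrix.specialOrthogonalGroup (Fin 2) ℝ,
    X = !![l, 0; 0, l ^ (p - 1)] * R}

/-- Smooth compactly supported test functions in `Ω`. -/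
structure IsTestFunction (Ω : Set Plane) (φ : Plane → ℝ) : Prop where
  contDiff : ContDiff ℝ ∞ φ
  hasCompactSupport : HasCompactSupport φ
  tsupport_subset : tsupport φ ⊆ Ω

/-- The locally integrable function `g` is the weak partial derivative `∂_j f` in `Ω` of the
locally integrable function `f`. -/
structure HasWeakPartial (Ω : Set Plane) (f : Plane → ℝ) (j : Fin 2) (g : Plane → ℝ) : Prop where
  locallyIntegrableOn_fun : LocallyIntegrableOn f Ω volume
  locallyIntegrableOn_deriv : LocallyIntegrableOn g Ω volume
  integral_eq : ∀ φ : Plane → ℝ, IsTestFunction Ω φ →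
    ∫ x in Ω, f x * fderiv ℝ φ x (EuclideanSpace.single j 1) = - ∫ x in Ω, g x * φ x

/-- `G` is the weak gradient of the map `u` in `Ω`; row `i` of `G x` is the gradient of the
`i`-th component of `u`. -/
def IsWeakGradient (Ω : Set Plane) (u : Plane → Plane) (G : Plane → Mat) : Prop :=
  ∀ i j : Fin 2, HasWeakPartial Ω (fun x => u x i) j (fun x => G x i j)

/-- The Sobolev space `W^{1,q}(Ω)` of maps into the plane. -/
def MemW1 (q : ℝ≥0∞) (Ω : Set Plane) (u : Plane → Plane) : Prop :=
  MemLp u q (volume.restrict Ω) ∧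
    ∃ G : Plane → Mat, IsWeakGradient Ω u G ∧ MemLp G q (volume.restrict Ω)

/-- The norm of `C^α(S)`: supremum norm plus Hölder seminorm (`∞` if the map is not in
`C^α(S)`). -/
noncomputable def holderNormOn (α : ℝ≥0) (S : Set Plane) (f : Plane → Plane) : ℝ≥0∞ :=
  (⨆ x ∈ S, ‖f x‖ₑ) + eHolderNorm α (S.domRestrict f)

/-- `u` is piecewise affine in `Ω`: up to a null set, `Ω` is a countable disjoint union of regular
domains on each of which `u` is affine. -/
def IsPiecewiseAffine (Ω : Set Plane) (u : Plane → Plane) : Prop :=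
  ∃ F : Set (Set Plane), F.Countable ∧ F.PairwiseDisjoint id ∧
    (∀ V ∈ F, IsRegularDomain V ∧ V ⊆ Ω) ∧ volume (Ω \ ⋃₀ F) = 0 ∧
    ∀ V ∈ F, ∃ (A : Mat) (b : Plane), ∀ x ∈ V, u x = affineMap A b x

/-- `v` is a distributional solution in `Ω` of `div (|∇v| ^ (p - 2) ∇v) = 0`, where `∇v` is the
weak gradient of `v` and the flux is required to be locally integrable. -/
def IsVeryWeakPLaplaceSolution (p : ℝ) (Ω : Set Plane) (v : Plane → ℝ) : Prop :=
  ∃ g : Plane → Plane, (∀ j : Fin 2, HasWeakPartial Ω v j (fun x => g x j)) ∧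
    LocallyIntegrableOn (fun x => ‖g x‖ ^ (p - 2) • g x) Ω volume ∧
    ∀ φ : Plane → ℝ, IsTestFunction Ω φ →
      ∫ x in Ω, fderiv ℝ φ x (‖g x‖ ^ (p - 2) • g x) = 0

end PLaplace

namespace PLaplace

open Metric Filter Topology
open scoped RealInnerProductSpace

/-! A matrix in `K p` has as its second row the flux `|z| ^ (p - 2) z` of its first row `z`, turned
by a right angle. Since the second row of `∇u` is itself a weak gradient, it is curl-free, and so
the flux of `∇u₁` is divergence-free (`isVeryWeakPLaplaceSolution_of_mem_K`). Everything else
concerns solving `∇u ∈ K p` with a prescribed power tail.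

The solution is a staircase. Given one nonzero row, the other can be replaced so that the matrix
enters `K p`; hence only the lengths of the two rows matter. From lengths `(x, (s x) ^ (p - 1))`, a
change of the first row puts a proportion `1 - β₁` into `K p`, with first row of length `s x`, and
the rest at `(2 x, (s x) ^ (p - 1))`. A change of the second row then puts a proportion `1 - β₂` of
this rest into `K p`, with first row of length `2 x`, and leaves `(2 x, (2 s x) ^ (p - 1))`: the
initial position with `x` doubled. One cycle doubles the gradient and multiplies the unresolved area
by `β₁ β₂ = 2 ^ (-q)`, which gives the tail `t ^ (-q)` and the divergence of the integral of the
`q`-th power. A split is possible when the barycentre of the two unresolved vertices is shorter than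
the vertices; for `p < 2` a suitable small `s` admits weights with `2 ^ (-p) < β₁ β₂ < 1 / 2`, that
is, `1 < q < p` (`exists_parameters`).

Each split is realised exactly, without transition layers. A scalar function supported in the piece
is added to one component of the map; its gradient takes three values surrounding the origin. Such a
function is a pyramid over a triangle, and Vitali's theorem fills the piece with small homothetic
triangles (`Surrounds.exists_scalar`). The areas are forced by the vanishing of the integral of a
directional derivative (`Surrounds.exists_scalar_weighted`).

The perturbations are as small as desired in sup norm, hence in `C^α`. Almost every point is
eventually resolved, and its gradient then stays fixed; because `q > 1`, the gradients have an
integrable majorant and the weak gradient passes to the limit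
(`IsStaircase.isWeakGradient_limitMap`). -/

/-! ### Gluing, and pyramids over triangles -/

/-- Functions with pairwise disjoint supports and a common Lipschitz constant can be glued at the
cost of doubling the constant. -/
theorem exists_lipschitz_glue {X ι E : Type*} [PseudoMetricSpace X] [SeminormedAddCommGroup E]
    {s : Set ι} {W : ι → Set X} (hW : s.PairwiseDisjoint W) {f : ι → X → E}
    (hf : ∀ a ∈ s, ∀ x, x ∉ W a → f a x = 0) {L : ℝ≥0} (hL : ∀ a ∈ s, LipschitzWith L (f a)) :
    ∃ φ : X → E, (∀ a ∈ s, ∀ x ∈ W a, φ x = f a x) ∧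
      (∀ x, (∀ a ∈ s, x ∉ W a) → φ x = 0) ∧ LipschitzWith (2 * L) φ := by
  classical
  let φ : X → E := fun x => if h : ∃ a ∈ s, x ∈ W a then f h.choose x else 0
  have h1 : ∀ a ∈ s, ∀ x ∈ W a, φ x = f a x := by
    intro a ha x hx
    have h : ∃ a ∈ s, x ∈ W a := ⟨a, ha, hx⟩
    have : h.choose = a := hW.elim_set h.choose_spec.1 ha x h.choose_spec.2 hx
    simp only [φ, dif_pos h, this]
  have h2 : ∀ x, (∀ a ∈ s, x ∉ W a) → φ x = 0 := by
    intro x hx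
    have h : ¬ ∃ a ∈ s, x ∈ W a := fun ⟨a, ha, hxa⟩ => hx a ha hxa
    simp only [φ, dif_neg h]
  refine ⟨φ, h1, h2, ?_⟩
  -- Two points in different sets are compared through the value 0 that each function takes at the
  -- other point; this costs the factor 2 and needs no path between the points.
  have key : ∀ a ∈ s, ∀ x ∈ W a, ∀ y, y ∉ W a → ‖φ x‖ ≤ L * dist x y := by
    intro a ha x hx y hy
    have := (hL a ha).dist_le_mul x y
    rwa [hf a ha y hy, dist_zero_right, ← h1 a ha x hx] at this
  refine LipschitzWith.of_dist_le_mul fun x y => ?_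
  have hd : 0 ≤ (L : ℝ) * dist x y := by positivity
  have hxy : ‖φ x‖ ≤ L * dist x y ∨ ∃ a ∈ s, x ∈ W a ∧ y ∈ W a := by
    by_cases h : ∃ a ∈ s, x ∈ W a
    · obtain ⟨a, ha, hx⟩ := h
      by_cases hy : y ∈ W a
      · exact .inr ⟨a, ha, hx, hy⟩
      · exact .inl (key a ha x hx y hy)
    · left
      rw [h2 x fun a ha hx => h ⟨a, ha, hx⟩, norm_zero]
      exact hd
  have hyx : ‖φ y‖ ≤ L * dist x y ∨ ∃ a ∈ s, x ∈ W a ∧ y ∈ W a := by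
    by_cases h : ∃ a ∈ s, y ∈ W a
    · obtain ⟨a, ha, hy⟩ := h
      by_cases hx : x ∈ W a
      · exact .inr ⟨a, ha, hx, hy⟩
      · exact .inl (dist_comm x y ▸ key a ha y hy x hx)
    · left
      rw [h2 y fun a ha hy => h ⟨a, ha, hy⟩, norm_zero]
      exact hd
  have h2L : ((2 * L : ℝ≥0) : ℝ) * dist x y = L * dist x y + L * dist x y := by
    push_cast
    ring
  rw [h2L]
  rcases hxy with hx | ⟨a, ha, hx, hy⟩
  · rcases hyx with hy | ⟨a, ha, hx', hy⟩
    · exact (dist_le_norm_add_norm _ _).trans (add_le_add hx hy)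
    · rw [h1 a ha x hx', h1 a ha y hy]
      linarith [(hL a ha).dist_le_mul x y]
  · rw [h1 a ha x hx, h1 a ha y hy]
    linarith [(hL a ha).dist_le_mul x y]

theorem volume_hyperplane {n : Plane} (hn : n ≠ 0) (c : ℝ) : volume {x : Plane | ⟪n, x⟫ = c} = 0 := by
  rcases Set.eq_empty_or_nonempty {x : Plane | ⟪n, x⟫ = c} with h | ⟨x₀, hx₀⟩
  · rw [h, measure_empty]
  have hs : {x : Plane | ⟪n, x⟫ = c} = (fun x => x + -x₀) ⁻¹' (LinearMap.ker (innerₛₗ ℝ n) : Set Plane) := by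
    ext x
    simp only [mem_ofPred_eq] at hx₀
    simp only [mem_ofPred_eq, mem_preimage, SetLike.mem_coe, LinearMap.mem_ker, innerₛₗ_apply_apply, inner_add_right, inner_neg_right, hx₀]
    constructor <;> intro h <;> linarith
  rw [hs, measure_preimage_add_right]
  refine Measure.addHaar_submodule _ _ fun h => hn ?_
  have : n ∈ LinearMap.ker (innerₛₗ ℝ n) := h ▸ Submodule.mem_top
  simpa using this

/-- Three vectors that contain the origin in the interior of their convex hull. -/
def Surrounds (ξ : Fin 3 → Plane) : Prop := ∀ y : Plane, y ≠ 0 → ∃ j, ⟪ξ j, y⟫ < 0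

/-- The minimum of the three linear forms is continuous and negative on the unit circle, so by
compactness it is bounded away from 0 there; homogeneity does the rest. This is what makes the
triangles bounded. -/
theorem Surrounds.exists_le {ξ : Fin 3 → Plane} (hξ : Surrounds ξ) :
    ∃ c : ℝ, 0 < c ∧ ∀ y : Plane, ∃ j, ⟪ξ j, y⟫ ≤ -(c * ‖y‖) := by
  let h : Plane → ℝ := fun y => min (⟪ξ 0, y⟫) (min (⟪ξ 1, y⟫) (⟪ξ 2, y⟫))
  have hh : Continuous h := by fun_prop
  have hlt : ∀ y : Plane, y ≠ 0 → h y < 0 := by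
    intro y hy
    obtain ⟨j, hj⟩ := hξ y hy
    fin_cases j
    · exact min_lt_of_left_lt hj
    · exact min_lt_of_right_lt (min_lt_of_left_lt hj)
    · exact min_lt_of_right_lt (min_lt_of_right_lt hj)
  obtain ⟨y₀, hy₀, hmax⟩ := (isCompact_sphere (0 : Plane) 1).exists_isMaxOn
    (NormedSpace.sphere_nonempty.2 zero_le_one) hh.continuousOn
  have hy₀' : y₀ ≠ 0 := by
    rintro rfl
    simp at hy₀
  refine ⟨-h y₀, neg_pos.2 (hlt y₀ hy₀'), fun y => ?_⟩
  rcases eq_or_ne y 0 with rfl | hy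
  · exact ⟨0, by simp⟩
  have hn : 0 < ‖y‖ := norm_pos_iff.2 hy
  have hle : h (‖y‖⁻¹ • y) ≤ h y₀ := hmax (by
    rw [mem_sphere_zero_iff_norm, norm_smul, norm_inv, norm_norm, inv_mul_cancel₀ hn.ne'])
  have hj : ∃ j, ⟪ξ j, ‖y‖⁻¹ • y⟫ ≤ h y₀ := by
    rcases min_le_iff.1 hle with h0 | h0
    · exact ⟨0, h0⟩
    rcases min_le_iff.1 h0 with h0 | h0
    · exact ⟨1, h0⟩
    · exact ⟨2, h0⟩
  obtain ⟨j, hj⟩ := hj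
  refine ⟨j, ?_⟩
  rw [inner_smul_right, inv_mul_le_iff₀ hn] at hj
  linarith

/-- The closed triangle `{x | ⟪ξ j, x - y⟫ ≥ -ε for all j}`. -/
def triangle (ξ : Fin 3 → Plane) (a : Plane × ℝ) : Set Plane :=
  {x | ∀ j, 0 ≤ a.2 + ⟪ξ j, x - a.1⟫}

/-- The pyramid over `triangle ξ a`. -/
noncomputable def pyramid (ξ : Fin 3 → Plane) (a : Plane × ℝ) (x : Plane) : ℝ :=
  max 0 (min (a.2 + ⟪ξ 0, x - a.1⟫) (min (a.2 + ⟪ξ 1, x - a.1⟫) (a.2 + ⟪ξ 2, x - a.1⟫)))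

/-- The open part of `triangle ξ a` on which the pyramid has gradient `ξ j`. -/
def sector (ξ : Fin 3 → Plane) (a : Plane × ℝ) (j : Fin 3) : Set Plane :=
  {x | 0 < a.2 + ⟪ξ j, x - a.1⟫ ∧ ∀ i, i ≠ j → ⟪ξ j, x - a.1⟫ < ⟪ξ i, x - a.1⟫}

theorem isClosed_triangle (ξ : Fin 3 → Plane) (a : Plane × ℝ) : IsClosed (triangle ξ a) := by
  simp only [triangle, ofPred_forall]
  exact isClosed_iInter fun j => isClosed_le continuous_const (by fun_prop)

theorem isOpen_sector (ξ : Fin 3 → Plane) (a : Plane × ℝ) (j : Fin 3) :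
    IsOpen (sector ξ a j) := by
  have : sector ξ a j = {x | 0 < a.2 + ⟪ξ j, x - a.1⟫} ∩
      ⋂ i, {x | i ≠ j → ⟪ξ j, x - a.1⟫ < ⟪ξ i, x - a.1⟫} := by
    ext x
    simp [sector]
  rw [this]
  refine (isOpen_lt continuous_const (by fun_prop)).inter (isOpen_iInter_of_finite fun i => ?_)
  by_cases h : i = j
  · simp [h]
  · simp only [ne_eq, h, not_false_eq_true, true_imp_iff]
    exact isOpen_lt (by fun_prop) (by fun_prop)

theorem convex_sector (ξ : Fin 3 → Plane) (a : Plane × ℝ) (j : Fin 3) :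
    Convex ℝ (sector ξ a j) := by
  intro x hx y hy s t hs ht hst
  have hc : ∀ i, ⟪ξ i, s • x + t • y - a.1⟫ = s * ⟪ξ i, x - a.1⟫ + t * ⟪ξ i, y - a.1⟫ := by
    intro i
    have : s • x + t • y - a.1 = s • (x - a.1) + t • (y - a.1) := by
      rw [smul_sub, smul_sub, sub_add_sub_comm, ← add_smul, hst, one_smul]
    rw [this, inner_add_right, inner_smul_right, inner_smul_right]
  have hpos : ∀ {u v : ℝ}, 0 < u → 0 < v → 0 < s * u + t * v := by
    intro u v hu hv
    rcases hs.eq_or_lt with rfl | hs'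
    · have : t = 1 := by linarith
      simpa [this] using hv
    · have := mul_pos hs' hu
      have := mul_nonneg ht hv.le
      linarith
  refine ⟨?_, fun i hi => ?_⟩
  · rw [hc]
    have := hpos hx.1 hy.1
    have h1 : a.2 = s * a.2 + t * a.2 := by rw [← add_mul, hst, one_mul]
    rw [h1]
    linarith
  · rw [hc, hc]
    have := hpos (sub_pos.2 (hx.2 i hi)) (sub_pos.2 (hy.2 i hi))
    linarith

theorem sector_subset_triangle (ξ : Fin 3 → Plane) (a : Plane × ℝ) (j : Fin 3) :
    sector ξ a j ⊆ triangle ξ a := by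
  intro x hx i
  by_cases h : i = j
  · exact h ▸ hx.1.le
  · linarith [hx.1, hx.2 i h]

theorem disjoint_sector (ξ : Fin 3 → Plane) (a : Plane × ℝ) {i j : Fin 3} (h : i ≠ j) :
    Disjoint (sector ξ a i) (sector ξ a j) :=
  disjoint_left.2 fun _ hx hy => lt_asymm (hx.2 j h.symm) (hy.2 i h)

theorem pyramid_eq_of_mem_sector {ξ : Fin 3 → Plane} {a : Plane × ℝ} {j : Fin 3} {x : Plane}
    (hx : x ∈ sector ξ a j) : pyramid ξ a x = a.2 + ⟪ξ j, x - a.1⟫ := by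
  have h0 := hx.1
  have h1 := hx.2
  unfold pyramid
  fin_cases j
  · have := h1 1 (by decide)
    have := h1 2 (by decide)
    simp only [Fin.zero_eta] at *
    rw [min_eq_left (le_min (by linarith) (by linarith)), max_eq_right h0.le]
  · have := h1 0 (by decide)
    have := h1 2 (by decide)
    simp only [Fin.mk_one] at *
    rw [min_eq_left (a := a.2 + ⟪ξ 1, x - a.1⟫) (by linarith), min_eq_right (by linarith), max_eq_right h0.le]
  · have := h1 0 (by decide)
    have := h1 1 (by decide)
    simp only [Fin.reduceFinMk] at *
    rw [min_eq_right (a := a.2 + ⟪ξ 1, x - a.1⟫) (by linarith), min_eq_right (by linarith), max_eq_right h0.le]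

theorem pyramid_eq_zero {ξ : Fin 3 → Plane} {a : Plane × ℝ} {x : Plane} (hx : x ∉ triangle ξ a) :
    pyramid ξ a x = 0 := by
  simp only [triangle, mem_ofPred_eq, not_forall, not_le] at hx
  obtain ⟨j, hj⟩ := hx
  refine max_eq_left ?_
  fin_cases j
  · exact min_le_of_left_le hj.le
  · exact min_le_of_right_le (min_le_of_left_le hj.le)
  · exact min_le_of_right_le (min_le_of_right_le hj.le)

theorem lipschitzWith_pyramid {ξ : Fin 3 → Plane} {L : ℝ≥0} (hL : ∀ j, ‖ξ j‖ ≤ L)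
    (a : Plane × ℝ) : LipschitzWith L (pyramid ξ a) := by
  have h : ∀ j, LipschitzWith L fun x : Plane => a.2 + ⟪ξ j, x - a.1⟫ := by
    intro j
    refine LipschitzWith.of_dist_le_mul fun x y => ?_
    rw [Real.dist_eq, add_sub_add_left_eq_sub, ← inner_sub_right, sub_sub_sub_cancel_right,
      dist_eq_norm]
    exact (abs_real_inner_le_norm _ _).trans (by gcongr; exact hL j)
  have := ((h 0).min ((h 1).min (h 2))).const_max 0
  rwa [max_self, max_self] at this

theorem pyramid_nonneg (ξ : Fin 3 → Plane) (a : Plane × ℝ) (x : Plane) : 0 ≤ pyramid ξ a x :=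
  le_max_left _ _

theorem Surrounds.pyramid_le {ξ : Fin 3 → Plane} (hξ : Surrounds ξ) {a : Plane × ℝ}
    (ha : 0 ≤ a.2) (x : Plane) : pyramid ξ a x ≤ a.2 := by
  obtain ⟨c, hc, h⟩ := hξ.exists_le
  obtain ⟨j, hj⟩ := h (x - a.1)
  have hj : a.2 + ⟪ξ j, x - a.1⟫ ≤ a.2 := by
    have : 0 ≤ c * ‖x - a.1‖ := by positivity
    linarith
  refine max_le ha ?_
  fin_cases j
  · exact min_le_of_left_le hj
  · exact min_le_of_right_le (min_le_of_left_le hj)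
  · exact min_le_of_right_le (min_le_of_right_le hj)

/-- Outside the sectors either two of the affine functions tie, which is a line because the `ξ j`
are distinct, or the smallest one vanishes. The latter is a line if `ξ j ≠ 0`, and cannot happen if
`ξ j = 0` because the height is positive. -/
theorem volume_triangle_diff_sector {ξ : Fin 3 → Plane} (hξ : Function.Injective ξ)
    {a : Plane × ℝ} (ha : 0 < a.2) : volume (triangle ξ a \ ⋃ j, sector ξ a j) = 0 := by
  have hsub : triangle ξ a \ ⋃ j, sector ξ a j ⊆
      (⋃ i, ⋃ j, ⋃ (_ : i ≠ j), {x | ⟪ξ i - ξ j, x⟫ = ⟪ξ i - ξ j, a.1⟫}) ∪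
        ⋃ j, ⋃ (_ : ξ j ≠ 0), {x | ⟪ξ j, x⟫ = ⟪ξ j, a.1⟫ - a.2} := by
    rintro x ⟨hx, hxs⟩
    by_contra hcon
    simp only [mem_union, mem_iUnion, mem_ofPred_eq, exists_prop, not_or, not_exists, not_and] at hcon
    obtain ⟨h1, h2⟩ := hcon
    obtain ⟨j, -, hj⟩ := Finset.exists_min_image Finset.univ (fun j => ⟪ξ j, x - a.1⟫) ⟨0, Finset.mem_univ _⟩
    refine hxs (mem_iUnion.2 ⟨j, (hx j).lt_of_ne fun h => ?_, fun i hi =>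
      (hj i (Finset.mem_univ _)).lt_of_ne fun h => ?_⟩)
    · refine h2 j ?_ ?_
      · intro h0
        rw [h0, inner_zero_left] at h
        linarith
      · rw [inner_sub_right] at h
        linarith
    · refine h1 i j hi ?_
      simp only [inner_sub_left, inner_sub_right] at h ⊢
      linarith
  refine measure_mono_null hsub ?_
  simp only [measure_union_null_iff, measure_iUnion_null_iff]
  exact ⟨fun i j hij => volume_hyperplane (sub_ne_zero.2 (hξ.ne hij)) _,
    fun j hj => volume_hyperplane hj _⟩

/-! ### Scalar functions with three prescribed gradients -/

/-- A countable disjoint family of regular domains. -/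
structure IsPieceFamily (P : Set (Set Plane)) : Prop where
  countable : P.Countable
  disjoint : P.PairwiseDisjoint id
  regular : ∀ V ∈ P, IsRegularDomain V

theorem IsPieceFamily.isOpen_sUnion {P : Set (Set Plane)} (hP : IsPieceFamily P) :
    IsOpen (⋃₀ P) := _root_.isOpen_sUnion fun V hV => (hP.regular V hV).isOpen

theorem IsPieceFamily.union {P Q : Set (Set Plane)} (hP : IsPieceFamily P) (hQ : IsPieceFamily Q)
    (h : Disjoint (⋃₀ P) (⋃₀ Q)) : IsPieceFamily (P ∪ Q) where
  countable := hP.countable.union hQ.countable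
  disjoint := hP.disjoint.union hQ.disjoint fun U hU V hV _ =>
    h.mono (subset_sUnion_of_mem hU) (subset_sUnion_of_mem hV)
  regular := by
    rintro V (hV | hV)
    exacts [hP.regular V hV, hQ.regular V hV]

theorem isRegularDomain_of_convex {U : Set Plane} (ho : IsOpen U) (hb : Bornology.IsBounded U)
    (hc : Convex ℝ U) (hn : U.Nonempty) : IsRegularDomain U :=
  ⟨ho, hb, ⟨hn, hc.isPreconnected⟩, hc.addHaar_frontier _⟩

/-- The basic scalar construction: a small function on `V`, piecewise affine with gradients among
three prescribed vectors surrounding the origin. -/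
theorem Surrounds.exists_scalar {ξ : Fin 3 → Plane} (hξ : Surrounds ξ)
    (hinj : Function.Injective ξ) {L : ℝ≥0} (hL : ∀ j, ‖ξ j‖ ≤ L) {V : Set Plane} (hV : IsOpen V)
    (hb : Bornology.IsBounded V) {η : ℝ} (hη : 0 < η) :
    ∃ (φ : Plane → ℝ) (F : Fin 3 → Set (Set Plane)),
      (∀ j, IsPieceFamily (F j)) ∧ (∀ i j, i ≠ j → Disjoint (⋃₀ F i) (⋃₀ F j)) ∧
      (∀ j, ∀ U ∈ F j, U ⊆ V ∧ ∃ b : ℝ, ∀ x ∈ U, φ x = ⟪ξ j, x⟫ + b) ∧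
      volume (V \ ⋃ j, ⋃₀ F j) = 0 ∧ LipschitzWith (2 * L) φ ∧ (∀ x, |φ x| ≤ η) ∧
      ∀ x, x ∉ V → φ x = 0 := by
  obtain ⟨c, hc, hcle⟩ := hξ.exists_le
  -- A pair consists of the apex point and the height of a pyramid. The bound `a.2 ≤ η` makes the
  -- glued function small.
  let t : Set (Plane × ℝ) := {a | 0 < a.2 ∧ a.2 ≤ η ∧ triangle ξ a ⊆ V}
  have htri : ∀ a : Plane × ℝ, triangle ξ a ⊆ closedBall a.1 (a.2 / c) := by
    intro a x hx
    obtain ⟨j, hj⟩ := hcle (x - a.1)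
    rw [mem_closedBall, dist_eq_norm, le_div_iff₀ hc]
    linarith [hx j]
  have hball : ∀ a : Plane × ℝ, 0 < a.2 → closedBall a.1 (a.2 / (L + 1)) ⊆ triangle ξ a := by
    intro a ha x hx j
    rw [mem_closedBall, dist_eq_norm, le_div_iff₀ (by positivity)] at hx
    have h1 := neg_le_of_abs_le (abs_real_inner_le_norm (ξ j) (x - a.1))
    have h2 : ‖ξ j‖ * ‖x - a.1‖ ≤ L * ‖x - a.1‖ := by gcongr; exact hL j
    nlinarith [norm_nonneg (x - a.1)]
  -- A triangle of height `ε` lies between balls of radii `ε / (L + 1)` and `ε / c` about the same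
  -- point, so the area of the tripled outer ball is at most `(3 (L + 1) / c) ^ 2` times that of the
  -- triangle.
  obtain ⟨s, hst, hsc, hsd, hs0⟩ := Vitali.exists_disjoint_covering_ae (volume : Measure Plane) V t
    (Real.toNNReal ((3 * (L + 1) / c) ^ 2)) (fun a => a.2 / c) (fun a => a.1) (triangle ξ)
    (fun a _ => htri a)
    (by
      intro a ha
      have ha0 : 0 < a.2 := ha.1
      refine le_trans ?_ (mul_le_mul_right (measure_mono (hball a ha0)) _)
      rw [Measure.addHaar_closedBall _ _ (by positivity), Measure.addHaar_closedBall _ _ (by positivity), ← mul_assoc]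
      gcongr
      rw [ENNReal.ofReal, ENNReal.ofReal, ← ENNReal.coe_mul, ENNReal.coe_le_coe, ← NNReal.coe_le_coe]
      simp only [finrank_euclideanSpace, Fintype.card_fin, NNReal.coe_mul]
      rw [Real.coe_toNNReal _ (by positivity), Real.coe_toNNReal _ (by positivity),
        Real.coe_toNNReal _ (by positivity), ← mul_pow]
      refine le_of_eq ?_
      congr 1
      field_simp)
    (fun a ha => ⟨a.1, interior_mono (hball a ha.1) (ball_subset_interior_closedBall
      (mem_ball_self (div_pos ha.1 (by positivity))))⟩)
    (fun a _ => isClosed_triangle ξ a)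
    (by
      intro x hx ε hε
      obtain ⟨r, hr, hrV⟩ := nhds_basis_closedBall.mem_iff.1 (hV.mem_nhds hx)
      refine ⟨(x, min η (min (c * ε) (c * r))), ⟨by positivity, min_le_left _ _, ?_⟩, ?_, rfl⟩
      · refine (htri _).trans ((closedBall_subset_closedBall ?_).trans hrV)
        rw [div_le_iff₀ hc, mul_comm r]
        exact (min_le_right _ _).trans (min_le_right _ _)
      · rw [div_le_iff₀ hc, mul_comm ε]
        exact (min_le_right _ _).trans (min_le_left _ _))
  obtain ⟨φ, hφ1, hφ2, hφL⟩ := exists_lipschitz_glue hsd (f := fun a => pyramid ξ a)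
    (fun a _ x hx => pyramid_eq_zero hx) (fun a _ => lipschitzWith_pyramid hL a)
  -- The empty set is removed because regular domains are nonempty and nothing here shows that each
  -- sector is.
  refine ⟨φ, fun j => (fun a => sector ξ a j) '' s \ {∅}, ?_, ?_, ?_, ?_, hφL, ?_, ?_⟩
  · intro j
    refine ⟨(hsc.image _).mono sdiff_subset, ?_, ?_⟩
    · rintro _ ⟨⟨a, ha, rfl⟩, -⟩ _ ⟨⟨b, hb, rfl⟩, -⟩ hab
      have hab' : a ≠ b := fun h => hab (h ▸ rfl)
      exact (hsd ha hb hab').mono (sector_subset_triangle _ _ _) (sector_subset_triangle _ _ _)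
    · rintro _ ⟨⟨a, ha, rfl⟩, hne⟩
      exact isRegularDomain_of_convex (isOpen_sector _ _ _)
        (hb.subset ((sector_subset_triangle _ _ _).trans (hst ha).2.2)) (convex_sector _ _ _)
        (nonempty_iff_ne_empty.2 hne)
  · intro i j hij
    rw [disjoint_left]
    rintro x ⟨_, ⟨⟨a, ha, rfl⟩, -⟩, hxa⟩ ⟨_, ⟨⟨b, hb, rfl⟩, -⟩, hxb⟩
    have hab : a = b := hsd.elim_set ha hb x (sector_subset_triangle _ _ _ hxa)
      (sector_subset_triangle _ _ _ hxb)
    subst hab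
    exact disjoint_left.1 (disjoint_sector ξ a hij) hxa hxb
  · rintro j _ ⟨⟨a, ha, rfl⟩, -⟩
    refine ⟨(sector_subset_triangle _ _ _).trans (hst ha).2.2, a.2 - ⟪ξ j, a.1⟫, fun x hx => ?_⟩
    rw [hφ1 a ha x (sector_subset_triangle _ _ _ hx), pyramid_eq_of_mem_sector hx, inner_sub_right]
    ring
  · have hsub : V \ ⋃ j, ⋃₀ ((fun a => sector ξ a j) '' s \ {∅}) ⊆
        (V \ ⋃ a ∈ s, triangle ξ a) ∪ ⋃ a ∈ s, triangle ξ a \ ⋃ j, sector ξ a j := by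
      rintro x ⟨hxV, hx⟩
      by_cases h : ∃ a ∈ s, x ∈ triangle ξ a
      · obtain ⟨a, ha, hxa⟩ := h
        refine .inr (mem_iUnion₂.2 ⟨a, ha, hxa, fun hxs => hx ?_⟩)
        obtain ⟨j, hj⟩ := mem_iUnion.1 hxs
        exact mem_iUnion.2 ⟨j, sector ξ a j, ⟨⟨a, ha, rfl⟩, nonempty_iff_ne_empty.1 ⟨x, hj⟩⟩, hj⟩
      · refine .inl ⟨hxV, fun hx' => h ?_⟩
        simpa using hx'
    refine measure_mono_null hsub (measure_union_null hs0 ?_)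
    rw [measure_biUnion_null_iff hsc]
    exact fun a ha => volume_triangle_diff_sector hinj (hst ha).1
  · intro x
    by_cases h : ∃ a ∈ s, x ∈ triangle ξ a
    · obtain ⟨a, ha, hxa⟩ := h
      rw [hφ1 a ha x hxa, abs_of_nonneg (pyramid_nonneg _ _ _)]
      exact (hξ.pyramid_le (hst ha).1.le x).trans (hst ha).2.1
    · rw [hφ2 x fun a ha hxa => h ⟨a, ha, hxa⟩, abs_zero]
      exact hη.le
  · intro x hx
    exact hφ2 x fun a ha hxa => hx ((hst ha).2.2 hxa)

theorem lineDeriv_eq_of_eqOn {U : Set Plane} (hU : IsOpen U) {f : Plane → ℝ} {ξ : Plane} {b : ℝ}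
    (h : ∀ x ∈ U, f x = ⟪ξ, x⟫ + b) {x : Plane} (hx : x ∈ U) (v : Plane) :
    lineDeriv ℝ f x v = ⟪ξ, v⟫ := by
  have h1 : f =ᶠ[𝓝 x] fun y => ⟪ξ, y⟫ + b := by
    filter_upwards [hU.mem_nhds hx] with y hy using h y hy
  rw [h1.lineDeriv_eq]
  have h2 : HasFDerivAt (fun y : Plane => ⟪ξ, y⟫ + b) (innerSL ℝ ξ) x :=
    (innerSL ℝ ξ).hasFDerivAt.add_const b
  rw [(h2.hasLineDerivAt v).lineDeriv]
  rfl

/-- Integration by parts against the constant function 1. -/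
theorem integral_lineDeriv_eq_zero {f : Plane → ℝ} {L : ℝ≥0} (hf : LipschitzWith L f)
    (hc : HasCompactSupport f) (v : Plane) : ∫ x, lineDeriv ℝ f x v = 0 := by
  have h := LipschitzWith.integral_lineDeriv_mul_eq (μ := (volume : Measure Plane)) (f := fun _ : Plane => (1 : ℝ))
    (LipschitzWith.const (1 : ℝ)) hf hc (-v)
  have h0 : ∀ x w : Plane, lineDeriv ℝ (fun _ : Plane => (1 : ℝ)) x w = 0 := fun x w => by
    simp [lineDeriv]
  simp only [h0, zero_mul, integral_zero, neg_neg, mul_one] at h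
  exact h.symm

/-- The scalar construction, with control of the area of the set on which the gradient is not
`ξ 0`. -/
theorem Surrounds.exists_scalar_weighted {ξ : Fin 3 → Plane} (hξ : Surrounds ξ)
    (hinj : Function.Injective ξ) {L : ℝ≥0} (hL : ∀ j, ‖ξ j‖ ≤ L) {ν : Plane} {β : ℝ}
    (h0 : ⟪ξ 0, ν⟫ = -β) (h1 : ⟪ξ 1, ν⟫ = 1 - β) (h2 : ⟪ξ 2, ν⟫ = 1 - β)
    {V : Set Plane} (hV : IsRegularDomain V) {η : ℝ} (hη : 0 < η) :
    ∃ (φ : Plane → ℝ) (Q P : Set (Set Plane)), IsPieceFamily Q ∧ IsPieceFamily P ∧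
      Disjoint (⋃₀ Q) (⋃₀ P) ∧ ⋃₀ Q ⊆ V ∧ ⋃₀ P ⊆ V ∧ volume (V \ (⋃₀ Q ∪ ⋃₀ P)) = 0 ∧
      volume (⋃₀ P) = ENNReal.ofReal β * volume V ∧
      (∀ U ∈ Q, ∃ b : ℝ, ∀ x ∈ U, φ x = ⟪ξ 0, x⟫ + b) ∧
      (∀ U ∈ P, ∃ j, j ≠ 0 ∧ ∃ b : ℝ, ∀ x ∈ U, φ x = ⟪ξ j, x⟫ + b) ∧
      LipschitzWith (2 * L) φ ∧ (∀ x, |φ x| ≤ η) ∧ ∀ x, x ∉ V → φ x = 0 := by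
  obtain ⟨φ, F, hF, hFd, hFV, hF0, hφL, hφη, hφ0⟩ :=
    hξ.exists_scalar hinj hL hV.isOpen hV.isBounded hη
  have hsub : ∀ j, ⋃₀ F j ⊆ V := fun j => sUnion_subset fun U hU => (hFV j U hU).1
  have hQ0 : Disjoint (⋃₀ F 0) (⋃₀ (F 1 ∪ F 2)) := by
    rw [sUnion_union]
    exact (hFd 0 1 (by decide)).union_right (hFd 0 2 (by decide))
  have hP : IsPieceFamily (F 1 ∪ F 2) := (hF 1).union (hF 2) (hFd 1 2 (by decide))
  have hPV : ⋃₀ (F 1 ∪ F 2) ⊆ V := by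
    rw [sUnion_union]
    exact union_subset (hsub 1) (hsub 2)
  have hnull : volume (V \ (⋃₀ F 0 ∪ ⋃₀ (F 1 ∪ F 2))) = 0 := by
    refine measure_mono_null (sdiff_subset_sdiff_right ?_) hF0
    refine iUnion_subset fun j => ?_
    rw [sUnion_union]
    fin_cases j
    exacts [subset_union_left, subset_union_left.trans subset_union_right,
      subset_union_right.trans subset_union_right]
  have hfinV : volume V ≠ ⊤ := hV.isBounded.measure_lt_top.ne
  have hfin : ∀ {A : Set Plane}, A ⊆ V → volume A ≠ ⊤ := fun h => measure_ne_top_of_subset h hfinV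
  refine ⟨φ, F 0, F 1 ∪ F 2, hF 0, hP, hQ0, hsub 0, hPV, hnull, ?_, fun U hU => (hFV 0 U hU).2, ?_, hφL,
    hφη, hφ0⟩
  · have hcs : HasCompactSupport φ := HasCompactSupport.of_support_subset_isCompact
      (hV.isBounded.isCompact_closure) fun x hx => subset_closure (by
        by_contra h
        exact hx (hφ0 x h))
    have hint := integral_lineDeriv_eq_zero hφL hcs ν
    have hd0 : ∀ x ∈ ⋃₀ F 0, lineDeriv ℝ φ x ν = -β := by
      rintro x ⟨U, hU, hx⟩
      obtain ⟨b, hb⟩ := (hFV 0 U hU).2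
      rw [lineDeriv_eq_of_eqOn ((hF 0).regular U hU).isOpen hb hx, h0]
    have hd1 : ∀ x ∈ ⋃₀ (F 1 ∪ F 2), lineDeriv ℝ φ x ν = 1 - β := by
      rintro x ⟨U, hU | hU, hx⟩
      · obtain ⟨b, hb⟩ := (hFV 1 U hU).2
        rw [lineDeriv_eq_of_eqOn ((hF 1).regular U hU).isOpen hb hx, h1]
      · obtain ⟨b, hb⟩ := (hFV 2 U hU).2
        rw [lineDeriv_eq_of_eqOn ((hF 2).regular U hU).isOpen hb hx, h2]
    have hd2 : ∀ x ∈ (closure V)ᶜ, lineDeriv ℝ φ x ν = 0 := by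
      intro x hx
      rw [lineDeriv_eq_of_eqOn (U := (closure V)ᶜ) (ξ := 0) (b := 0) isClosed_closure.isOpen_compl ?_ hx,
        inner_zero_left]
      intro y hy
      rw [hφ0 y fun h => hy (subset_closure h), inner_zero_left, zero_add]
    -- The derivative along `ν` is `-β` on `Q` and `1 - β` on `P`. Its integral vanishes, so `β |Q|
    -- = (1 - β) |P|`, that is, `|P| = β |V|`.
    have hae : (fun x => lineDeriv ℝ φ x ν) =ᵐ[volume] fun x =>
        (⋃₀ F 0).indicator (fun _ => -β) x + (⋃₀ (F 1 ∪ F 2)).indicator (fun _ => 1 - β) x := by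
      have hn : volume (V \ (⋃₀ F 0 ∪ ⋃₀ (F 1 ∪ F 2)) ∪ frontier V) = 0 :=
        measure_union_null hnull hV.volume_frontier
      filter_upwards [compl_mem_ae_iff.2 hn] with x hx
      simp only [mem_compl_iff, mem_union, Set.mem_sdiff, not_or, not_and, not_not] at hx
      by_cases hxV : x ∈ V
      · rcases or_iff_not_imp_left.2 (hx.1 hxV) with h | h
        · rw [hd0 x h, indicator_of_mem h, indicator_of_notMem (disjoint_left.1 hQ0 h), add_zero]
        · rw [hd1 x h, indicator_of_mem h, indicator_of_notMem (disjoint_right.1 hQ0 h), zero_add]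
      · rw [hd2 x, indicator_of_notMem fun h => hxV (hsub 0 h), indicator_of_notMem fun h => hxV (hPV h), add_zero]
        intro hc
        exact hx.2 ⟨hc, fun hi => hxV (interior_subset hi)⟩
    have hm0 := (hF 0).isOpen_sUnion.measurableSet
    have hm1 := hP.isOpen_sUnion.measurableSet
    rw [integral_congr_ae hae, integral_add, integral_indicator_const _ hm0,
      integral_indicator_const _ hm1] at hint
    rotate_left
    · exact (integrable_indicator_iff hm0).2 (integrableOn_const (hfin (hsub 0)))
    · exact (integrable_indicator_iff hm1).2 (integrableOn_const (hfin hPV))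
    have hsum : volume.real V = volume.real (⋃₀ F 0) + volume.real (⋃₀ (F 1 ∪ F 2)) := by
      rw [← measureReal_union hQ0 hm1 (hfin (hsub 0)) (hfin hPV)]
      refine measureReal_congr ?_
      refine (ae_eq_set.2 ⟨hnull, ?_⟩)
      rw [sdiff_eq_empty.2 (union_subset (hsub 0) hPV), measure_empty]
    have hβ : volume.real (⋃₀ (F 1 ∪ F 2)) = β * volume.real V := by
      rw [hsum]
      simp only [smul_eq_mul] at hint
      linarith
    -- A negative `β` would give `P` negative area; this case only arises because the sign of `β` is
    -- not assumed.
    rcases le_or_gt 0 β with hβ0 | hβ0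
    · rw [← ENNReal.ofReal_toReal (hfin hPV), ← ENNReal.ofReal_toReal hfinV, ← ENNReal.ofReal_mul hβ0]
      exact congrArg _ hβ
    · have hpos : 0 < volume.real V :=
        ENNReal.toReal_pos (hV.isOpen.measure_pos _ hV.isConnected.nonempty).ne' hfinV
      have : 0 ≤ volume.real (⋃₀ (F 1 ∪ F 2)) := measureReal_nonneg
      nlinarith
  · rintro U (hU | hU)
    · exact ⟨1, by decide, (hFV 1 U hU).2⟩
    · exact ⟨2, by decide, (hFV 2 U hU).2⟩

/-! ### Splitting one row of a gradient on all pieces -/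

/-- The `i`-th row of a matrix. -/
def row (C : Mat) (i : Fin 2) : Plane := WithLp.toLp 2 (C i)

/-- Replace the `i`-th row of a matrix. -/
def setRow (C : Mat) (i : Fin 2) (z : Plane) : Mat := C.updateRow i (WithLp.ofLp z)

@[simp] theorem row_apply (C : Mat) (i j : Fin 2) : row C i j = C i j := rfl

@[simp] theorem row_setRow_self (C : Mat) (i : Fin 2) (z : Plane) : row (setRow C i z) i = z := by
  simp [row, setRow]

theorem row_setRow_of_ne (C : Mat) {i k : Fin 2} (h : k ≠ i) (z : Plane) :
    row (setRow C i z) k = row C k := by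
  simp [row, setRow, Matrix.updateRow_ne h]

theorem affineMap_apply (A : Mat) (b x : Plane) (k : Fin 2) :
    affineMap A b x k = ⟪row A k, x⟫ + b k := by
  fin_cases k <;> simp [affineMap, Matrix.toLpLin_apply, row, PiLp.inner_apply, mul_comm]

theorem norm_sq_eq_row (A : Mat) : ‖A‖ ^ 2 = ‖row A 0‖ ^ 2 + ‖row A 1‖ ^ 2 := by
  rw [Matrix.frobenius_norm_def, ← Real.sqrt_eq_rpow, Real.sq_sqrt (by positivity),
    EuclideanSpace.norm_sq_eq, EuclideanSpace.norm_sq_eq]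
  simp

theorem norm_row_le (A : Mat) (i : Fin 2) : ‖row A i‖ ≤ ‖A‖ := by
  refine (sq_le_sq₀ (norm_nonneg _) (norm_nonneg _)).1 ?_
  rw [norm_sq_eq_row]
  fin_cases i
  · exact le_add_of_nonneg_right (sq_nonneg _)
  · exact le_add_of_nonneg_left (sq_nonneg _)

/-- `C` splits by changing one row into a matrix of `T` and two matrices of `S`, the latter having
total weight `β`. -/
def Splits (β : ℝ) (L : ℝ≥0) (C : Mat) (T S : Set Mat) : Prop :=
  ∃ (i : Fin 2) (ξ : Fin 3 → Plane) (ν : Plane), Surrounds ξ ∧ Function.Injective ξ ∧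
    (∀ j, ‖ξ j‖ ≤ L) ∧ ⟪ξ 0, ν⟫ = -β ∧ ⟪ξ 1, ν⟫ = 1 - β ∧ ⟪ξ 2, ν⟫ = 1 - β ∧
    setRow C i (row C i + ξ 0) ∈ T ∧ ∀ j, j ≠ 0 → setRow C i (row C i + ξ j) ∈ S

theorem affineMap_setRow_add (C : Mat) (i : Fin 2) (ξ b : Plane) (b' : ℝ) (x : Plane) :
    affineMap C b x + (⟪ξ, x⟫ + b') • EuclideanSpace.single i (1 : ℝ) =
      affineMap (setRow C i (row C i + ξ)) (b + b' • EuclideanSpace.single i (1 : ℝ)) x := by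
  ext k
  rw [PiLp.add_apply, affineMap_apply, affineMap_apply]
  by_cases h : k = i
  · subst h
    simp [inner_add_left]
    ring
  · rw [row_setRow_of_ne _ h]
    simp [h]

/-- `u` is affine on each member of `P`, with gradient in `S`. -/
def AffineOnPieces (u : Plane → Plane) (P : Set (Set Plane)) (S : Set Mat) : Prop :=
  ∀ V ∈ P, ∃ A ∈ S, ∃ b : Plane, ∀ x ∈ V, u x = affineMap A b x

/-- Adding a scalar function times the `i`-th basis vector changes only the `i`-th row of the
gradient, so the scalar construction applies directly. -/
theorem Splits.exists_perturbation {β : ℝ} {L : ℝ≥0} {C : Mat} {T S : Set Mat}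
    (h : Splits β L C T S) {V : Set Plane} (hV : IsRegularDomain V) {u : Plane → Plane} {b : Plane}
    (hu : ∀ x ∈ V, u x = affineMap C b x) {η : ℝ} (hη : 0 < η) :
    ∃ (φ : Plane → Plane) (Q P : Set (Set Plane)), IsPieceFamily Q ∧ IsPieceFamily P ∧
      Disjoint (⋃₀ Q) (⋃₀ P) ∧ ⋃₀ Q ⊆ V ∧ ⋃₀ P ⊆ V ∧ volume (V \ (⋃₀ Q ∪ ⋃₀ P)) = 0 ∧
      volume (⋃₀ P) = ENNReal.ofReal β * volume V ∧
      AffineOnPieces (u + φ) Q T ∧ AffineOnPieces (u + φ) P S ∧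
      LipschitzWith (2 * L) φ ∧ (∀ x, ‖φ x‖ ≤ η) ∧ ∀ x, x ∉ V → φ x = 0 := by
  obtain ⟨i, ξ, ν, hξ, hinj, hL, h0, h1, h2, hT, hS⟩ := h
  obtain ⟨φ, Q, P, hQ, hP, hQP, hQV, hPV, hnull, hvol, hQφ, hPφ, hLφ, hφη, hφ0⟩ :=
    hξ.exists_scalar_weighted hinj hL h0 h1 h2 hV hη
  refine ⟨fun x => φ x • EuclideanSpace.single i (1 : ℝ), Q, P, hQ, hP, hQP, hQV, hPV, hnull, hvol,
    fun U hU => ?_, fun U hU => ?_, ?_, fun x => ?_, fun x hx => ?_⟩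
  · obtain ⟨b', hb'⟩ := hQφ U hU
    refine ⟨_, hT, b + b' • EuclideanSpace.single i (1 : ℝ), fun x hx => ?_⟩
    rw [Pi.add_apply, hu x (hQV ⟨U, hU, hx⟩), hb' x hx, affineMap_setRow_add]
  · obtain ⟨j, hj, b', hb'⟩ := hPφ U hU
    refine ⟨_, hS j hj, b + b' • EuclideanSpace.single i (1 : ℝ), fun x hx => ?_⟩
    rw [Pi.add_apply, hu x (hPV ⟨U, hU, hx⟩), hb' x hx, affineMap_setRow_add]
  · refine LipschitzWith.of_dist_le_mul fun x y => ?_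
    rw [dist_eq_norm, ← sub_smul, norm_smul, PiLp.norm_single, norm_one, mul_one,
      ← dist_eq_norm]
    exact hLφ.dist_le_mul x y
  · rw [norm_smul, PiLp.norm_single, norm_one, mul_one]
    exact hφη x
  · simp only [hφ0 x hx, zero_smul]

theorem IsPieceFamily.iUnion {ι : Type*} [Countable ι] {W : ι → Set Plane}
    (hW : Pairwise fun i j => Disjoint (W i) (W j)) {Q : ι → Set (Set Plane)}
    (hQ : ∀ i, IsPieceFamily (Q i)) (hQW : ∀ i, ⋃₀ Q i ⊆ W i) : IsPieceFamily (⋃ i, Q i) where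
  countable := countable_iUnion fun i => (hQ i).countable
  disjoint := by
    intro U hU V hV hUV
    obtain ⟨i, hi⟩ := mem_iUnion.1 hU
    obtain ⟨j, hj⟩ := mem_iUnion.1 hV
    by_cases hij : i = j
    · subst hij
      exact (hQ i).disjoint hi hj hUV
    · exact (hW hij).mono ((subset_sUnion_of_mem hi).trans (hQW i))
        ((subset_sUnion_of_mem hj).trans (hQW j))
  regular := by
    intro U hU
    obtain ⟨i, hi⟩ := mem_iUnion.1 hU
    exact (hQ i).regular U hi

/-- One step of the construction: all pieces are split simultaneously. -/
theorem exists_refinement {β : ℝ} {L : ℝ≥0} {R T S : Set Mat} (hR : ∀ C ∈ R, Splits β L C T S)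
    {P : Set (Set Plane)} (hP : IsPieceFamily P) {u : Plane → Plane} (hu : AffineOnPieces u P R)
    {η : ℝ} (hη : 0 < η) :
    ∃ (φ : Plane → Plane) (Q P' : Set (Set Plane)), IsPieceFamily Q ∧ IsPieceFamily P' ∧
      Disjoint (⋃₀ Q) (⋃₀ P') ∧ ⋃₀ Q ⊆ ⋃₀ P ∧ ⋃₀ P' ⊆ ⋃₀ P ∧
      volume (⋃₀ P \ (⋃₀ Q ∪ ⋃₀ P')) = 0 ∧
      volume (⋃₀ P') = ENNReal.ofReal β * volume (⋃₀ P) ∧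
      AffineOnPieces (u + φ) Q T ∧ AffineOnPieces (u + φ) P' S ∧
      LipschitzWith (4 * L) φ ∧ (∀ x, ‖φ x‖ ≤ η) ∧ ∀ x, x ∉ ⋃₀ P → φ x = 0 := by
  have hex : ∀ V : P, ∃ (φ : Plane → Plane) (Q P : Set (Set Plane)), IsPieceFamily Q ∧
      IsPieceFamily P ∧ Disjoint (⋃₀ Q) (⋃₀ P) ∧ ⋃₀ Q ⊆ V ∧ ⋃₀ P ⊆ V ∧
      volume (V \ (⋃₀ Q ∪ ⋃₀ P)) = 0 ∧ volume (⋃₀ P) = ENNReal.ofReal β * volume (V : Set Plane) ∧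
      AffineOnPieces (u + φ) Q T ∧ AffineOnPieces (u + φ) P S ∧
      LipschitzWith (2 * L) φ ∧ (∀ x, ‖φ x‖ ≤ η) ∧ ∀ x, x ∉ (V : Set Plane) → φ x = 0 := by
    intro V
    obtain ⟨A, hA, b, hb⟩ := hu V V.2
    exact (hR A hA).exists_perturbation (hP.regular V V.2) hb hη
  choose f Q P' hQ hP' hQP hQV hPV hnull hvol hQu hPu hfL hfη hf0 using hex
  have hW : Pairwise fun i j : P => Disjoint (i : Set Plane) j := fun i j hij =>
    hP.disjoint i.2 j.2 (Subtype.coe_ne_coe.2 hij)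
  have hcount : Countable P := hP.countable.to_subtype
  obtain ⟨φ, hφ1, hφ2, hφL⟩ := exists_lipschitz_glue (s := univ) (W := fun V : P => (V : Set Plane))
    (fun i _ j _ hij => hW hij) (f := f) (fun V _ => hf0 V) (fun V _ => hfL V)
  have hQ' : ⋃₀ (⋃ V, Q V) ⊆ ⋃₀ P := by
    rw [sUnion_iUnion]
    exact iUnion_subset fun V => (hQV V).trans (subset_sUnion_of_mem V.2)
  have hP'' : ⋃₀ (⋃ V, P' V) ⊆ ⋃₀ P := by
    rw [sUnion_iUnion]
    exact iUnion_subset fun V => (hPV V).trans (subset_sUnion_of_mem V.2)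
  have haff : ∀ (F : P → Set (Set Plane)) (S : Set Mat), (∀ V, ⋃₀ F V ⊆ V) →
      (∀ V, AffineOnPieces (u + f V) (F V) S) → AffineOnPieces (u + φ) (⋃ V, F V) S := by
    intro F S hFV hF U hU
    obtain ⟨V, hUV⟩ := mem_iUnion.1 hU
    obtain ⟨A, hA, b, hb⟩ := hF V U hUV
    refine ⟨A, hA, b, fun x hx => ?_⟩
    rw [← hb x hx, Pi.add_apply, Pi.add_apply, hφ1 V (mem_univ V) x (hFV V ⟨U, hUV, hx⟩)]
  refine ⟨φ, ⋃ V, Q V, ⋃ V, P' V, IsPieceFamily.iUnion hW hQ hQV, IsPieceFamily.iUnion hW hP' hPV,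
    ?_, hQ', hP'', ?_, ?_, haff Q T hQV hQu, haff P' S hPV hPu, ?_, fun x => ?_, fun x hx => ?_⟩
  · rw [sUnion_iUnion, sUnion_iUnion, disjoint_iUnion_left]
    intro V
    rw [disjoint_iUnion_right]
    intro V'
    by_cases h : V = V'
    · exact h ▸ hQP V
    · exact (hW h).mono (hQV V) (hPV V')
  · have : ⋃₀ P \ (⋃₀ (⋃ V, Q V) ∪ ⋃₀ (⋃ V, P' V)) ⊆ ⋃ V : P, (V : Set Plane) \ (⋃₀ Q V ∪ ⋃₀ P' V) := by
      rintro x ⟨⟨V, hV, hx⟩, hn⟩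
      refine mem_iUnion.2 ⟨⟨V, hV⟩, hx, fun h => hn ?_⟩
      rw [sUnion_iUnion, sUnion_iUnion]
      exact h.imp (fun h => mem_iUnion.2 ⟨_, h⟩) fun h => mem_iUnion.2 ⟨_, h⟩
    exact measure_mono_null this (measure_iUnion_null hnull)
  · rw [sUnion_iUnion, measure_iUnion (fun i j hij => (hW hij).mono (hPV i) (hPV j))
      fun V => (hP' V).isOpen_sUnion.measurableSet, sUnion_eq_iUnion, measure_iUnion hW
      fun V => (hP.regular V V.2).isOpen.measurableSet, ← ENNReal.tsum_mul_left]
    exact tsum_congr hvol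
  -- One doubling comes from gluing the pyramids in a piece, the other from gluing the pieces.
  · rw [show 4 * L = 2 * (2 * L) by ring]
    exact hφL
  · by_cases h : ∃ V ∈ P, x ∈ V
    · obtain ⟨V, hV, hx⟩ := h
      rw [hφ1 ⟨V, hV⟩ (mem_univ _) x hx]
      exact hfη _ x
    · rw [hφ2 x fun V _ hx => h ⟨V, V.2, hx⟩, norm_zero]
      exact hη.le
  · exact hφ2 x fun V _ hxV => hx ⟨V, V.2, hxV⟩

/-- Every matrix of `R` splits, either with weight `κ` on `S` and the rest on `T`, or entirely into
matrices of `S`. -/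
def StepRule (κ : ℝ) (L : ℝ≥0) (R T S : Set Mat) : Prop :=
  (∀ C ∈ R, Splits κ L C T S) ∨ (κ = 1 ∧ ∃ β, ∀ C ∈ R, Splits β L C S S)

/-- The conclusion of `exists_refinement`. -/
structure IsRefinement (κ : ℝ) (L : ℝ≥0) (T S : Set Mat) (η : ℝ) (u u' : Plane → Plane)
    (P Q P' : Set (Set Plane)) : Prop where
  done : IsPieceFamily Q
  active : IsPieceFamily P'
  disjoint : Disjoint (⋃₀ Q) (⋃₀ P')
  done_subset : ⋃₀ Q ⊆ ⋃₀ P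
  active_subset : ⋃₀ P' ⊆ ⋃₀ P
  null : volume (⋃₀ P \ (⋃₀ Q ∪ ⋃₀ P')) = 0
  volume_active : volume (⋃₀ P') = ENNReal.ofReal κ * volume (⋃₀ P)
  affine_done : AffineOnPieces u' Q T
  affine_active : AffineOnPieces u' P' S
  lipschitz : LipschitzWith (4 * L) (u' - u)
  small : ∀ x, ‖u' x - u x‖ ≤ η
  eq_of_notMem : ∀ x, x ∉ ⋃₀ P → u' x = u x

theorem StepRule.exists_refinement {κ : ℝ} {L : ℝ≥0} {R T S : Set Mat} (hR : StepRule κ L R T S)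
    {P : Set (Set Plane)} (hP : IsPieceFamily P) {u : Plane → Plane} (hu : AffineOnPieces u P R)
    {η : ℝ} (hη : 0 < η) :
    ∃ (u' : Plane → Plane) (Q P' : Set (Set Plane)), IsRefinement κ L T S η u u' P Q P' := by
  rcases hR with hR | ⟨rfl, β, hR⟩
  · obtain ⟨φ, Q, P', hQ, hP', hQP, hQs, hPs, hn, hv, hQa, hPa, hL, hs, h0⟩ :=
      PLaplace.exists_refinement hR hP hu hη
    refine ⟨u + φ, Q, P', hQ, hP', hQP, hQs, hPs, hn, hv, hQa, hPa, ?_, fun x => ?_, fun x hx => ?_⟩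
    · rwa [add_sub_cancel_left]
    · rw [Pi.add_apply, add_sub_cancel_left]
      exact hs x
    · rw [Pi.add_apply, h0 x hx, add_zero]
  · obtain ⟨φ, Q, P', hQ, hP', hQP, hQs, hPs, hn, hv, hQa, hPa, hL, hs, h0⟩ :=
      PLaplace.exists_refinement hR hP hu hη
    have hU : ⋃₀ (Q ∪ P') ⊆ ⋃₀ P := sUnion_union Q P' ▸ union_subset hQs hPs
    have hn' : volume (⋃₀ P \ ⋃₀ (Q ∪ P')) = 0 := by rwa [sUnion_union]
    -- All three vertices lie in `S`, so nothing is declared finished and the whole area stays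
    -- active.
    refine ⟨u + φ, ∅, Q ∪ P', ⟨countable_empty, pairwiseDisjoint_empty, by simp⟩, hQ.union hP' hQP,
      by simp, by simp, hU, by simpa [sUnion_union] using hn', ?_, by simp [AffineOnPieces], ?_, ?_,
      fun x => ?_, fun x hx => ?_⟩
    · rw [ENNReal.ofReal_one, one_mul]
      exact measure_congr (ae_eq_set.2 ⟨by rw [sdiff_eq_empty.2 hU, measure_empty], hn'⟩)
    · rintro V (hV | hV)
      exacts [hQa V hV, hPa V hV]
    · rwa [add_sub_cancel_left]
    · rw [Pi.add_apply, add_sub_cancel_left]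
      exact hs x
    · rw [Pi.add_apply, h0 x hx, add_zero]

/-! ### Staircases: iterated refinements and their areas -/

theorem exists_seq_of_step {X : Type*} (I : ℕ → X → Prop) (R : ℕ → X → X → Prop) (x₀ : X)
    (h₀ : I 0 x₀) (h : ∀ n x, I n x → ∃ y, I (n + 1) y ∧ R n x y) :
    ∃ f : ℕ → X, f 0 = x₀ ∧ ∀ n, I n (f n) ∧ R n (f n) (f (n + 1)) := by
  choose! g hg using h
  let f : ℕ → X := fun n => Nat.rec x₀ g n
  have hI : ∀ n, I n (f n) := by
    intro n
    induction n with
    | zero => exact h₀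
    | succ n ih => exact (hg n _ ih).1
  exact ⟨f, rfl, fun n => ⟨hI n, (hg n _ (hI n)).2⟩⟩

/-- A staircase: a sequence of successive refinements of the affine map on `Ω`. -/
structure IsStaircase (Ω : Set Plane) (A : Mat) (b : Plane) (κ : ℕ → ℝ) (L : ℕ → ℝ≥0)
    (S T : ℕ → Set Mat) (η : ℕ → ℝ) (u : ℕ → Plane → Plane) (P Q : ℕ → Set (Set Plane)) : Prop where
  map_zero : u 0 = affineMap A b
  active_zero : P 0 = {Ω}
  isPieceFamily : ∀ n, IsPieceFamily (P n)
  affine : ∀ n, AffineOnPieces (u n) (P n) (S n)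
  step : ∀ n, IsRefinement (κ n) (L n) (T n) (S (n + 1)) (η n) (u n) (u (n + 1)) (P n) (Q n) (P (n + 1))

theorem exists_isStaircase {Ω : Set Plane} (hΩ : IsRegularDomain Ω) {A : Mat} (b : Plane)
    {κ : ℕ → ℝ} {L : ℕ → ℝ≥0} {S T : ℕ → Set Mat} (hA : A ∈ S 0)
    (h : ∀ n, StepRule (κ n) (L n) (S n) (T n) (S (n + 1))) {η : ℕ → ℝ} (hη : ∀ n, 0 < η n) :
    ∃ (u : ℕ → Plane → Plane) (P Q : ℕ → Set (Set Plane)), IsStaircase Ω A b κ L S T η u P Q := by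
  obtain ⟨f, hf0, hf⟩ := exists_seq_of_step
    (I := fun n (x : (Plane → Plane) × Set (Set Plane)) => IsPieceFamily x.2 ∧ AffineOnPieces x.1 x.2 (S n))
    (R := fun n x y => ∃ Q, IsRefinement (κ n) (L n) (T n) (S (n + 1)) (η n) x.1 y.1 x.2 Q y.2)
    (affineMap A b, {Ω})
    ⟨⟨countable_singleton Ω, pairwiseDisjoint_singleton Ω id, by simpa using hΩ⟩, by
      rintro V rfl
      exact ⟨A, hA, b, fun x _ => rfl⟩⟩
    (fun n x hx => by
      obtain ⟨u', Q, P', hQ⟩ := (h n).exists_refinement hx.1 hx.2 (hη n)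
      exact ⟨(u', P'), ⟨hQ.active, hQ.affine_active⟩, Q, hQ⟩)
  choose Q hQ using fun n => (hf n).2
  exact ⟨fun n => (f n).1, fun n => (f n).2, Q, by rw [hf0], by rw [hf0], fun n => (hf n).1.1,
    fun n => (hf n).1.2, hQ⟩

namespace IsStaircase

variable {Ω : Set Plane} {A : Mat} {b : Plane} {κ : ℕ → ℝ} {L : ℕ → ℝ≥0}
  {S T : ℕ → Set Mat} {η : ℕ → ℝ} {u : ℕ → Plane → Plane} {P Q : ℕ → Set (Set Plane)}

theorem antitone (h : IsStaircase Ω A b κ L S T η u P Q) : Antitone fun n => ⋃₀ P n :=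
  antitone_nat_of_succ_le fun n => (h.step n).active_subset

theorem sUnion_zero (h : IsStaircase Ω A b κ L S T η u P Q) : ⋃₀ P 0 = Ω := by
  rw [h.active_zero, sUnion_singleton]

theorem active_subset (h : IsStaircase Ω A b κ L S T η u P Q) (n : ℕ) : ⋃₀ P n ⊆ Ω :=
  h.sUnion_zero ▸ h.antitone (Nat.zero_le n)

theorem done_subset (h : IsStaircase Ω A b κ L S T η u P Q) (n : ℕ) : ⋃₀ Q n ⊆ Ω :=
  (h.step n).done_subset.trans (h.active_subset n)

theorem notMem_active (h : IsStaircase Ω A b κ L S T η u P Q) {n m : ℕ} (hnm : n < m) {x : Plane}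
    (hx : x ∈ ⋃₀ Q n) : x ∉ ⋃₀ P m := fun hm =>
  disjoint_left.1 (h.step n).disjoint hx (h.antitone hnm hm)

theorem disjoint_done (h : IsStaircase Ω A b κ L S T η u P Q) :
    Pairwise fun n m => Disjoint (⋃₀ Q n) (⋃₀ Q m) := by
  have key : ∀ n m, n < m → Disjoint (⋃₀ Q n) (⋃₀ Q m) := fun n m hnm =>
    disjoint_left.2 fun x hx hm => h.notMem_active hnm hx ((h.step m).done_subset hm)
  intro n m hnm
  rcases hnm.lt_or_gt with h' | h'
  exacts [key n m h', (key m n h').symm]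

theorem volume_active (h : IsStaircase Ω A b κ L S T η u P Q) (hκ : ∀ n, 0 ≤ κ n) (n : ℕ) :
    volume (⋃₀ P n) = ENNReal.ofReal (∏ i ∈ Finset.range n, κ i) * volume Ω := by
  induction n with
  | zero => simp [h.sUnion_zero]
  | succ n ih =>
    rw [(h.step n).volume_active, ih, Finset.prod_range_succ, mul_comm _ (κ n),
      ENNReal.ofReal_mul (hκ n), mul_assoc]

theorem volume_done (h : IsStaircase Ω A b κ L S T η u P Q) (hκ : ∀ n, 0 ≤ κ n) (n : ℕ)
    (hΩ : volume Ω ≠ ⊤) :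
    volume (⋃₀ Q n) =
      ENNReal.ofReal ((1 - κ n) * ∏ i ∈ Finset.range n, κ i) * volume Ω := by
  have hs := h.step n
  have h1 : volume (⋃₀ Q n) + volume (⋃₀ P (n + 1)) = volume (⋃₀ P n) := by
    rw [← measure_union hs.disjoint hs.active.isOpen_sUnion.measurableSet]
    exact measure_congr (ae_eq_set.2 ⟨by
      rw [sdiff_eq_empty.2 (union_subset hs.done_subset hs.active_subset), measure_empty], hs.null⟩)
  have hfin : volume (⋃₀ P (n + 1)) ≠ ⊤ := measure_ne_top_of_subset (h.active_subset _) hΩ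
  rw [ENNReal.eq_sub_of_add_eq hfin h1, h.volume_active hκ, h.volume_active hκ,
    Finset.prod_range_succ, ← ENNReal.sub_mul fun _ _ => hΩ, ← ENNReal.ofReal_sub _
      (mul_nonneg (Finset.prod_nonneg fun i _ => hκ i) (hκ n))]
  congr 2
  ring

/-- Apart from the null sets lost at the individual steps, a point that is never finished is active
at every level, and the active areas tend to 0. -/
theorem ae_mem_done (h : IsStaircase Ω A b κ L S T η u P Q) (hκ : ∀ n, 0 ≤ κ n)
    (hΩ : volume Ω ≠ ⊤)
    (hlim : Tendsto (fun n => ∏ i ∈ Finset.range n, κ i) atTop (𝓝 0)) :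
    volume (Ω \ ⋃ n, ⋃₀ Q n) = 0 := by
  have hsub : Ω \ ⋃ n, ⋃₀ Q n ⊆
      (⋃ n, ⋃₀ P n \ (⋃₀ Q n ∪ ⋃₀ P (n + 1))) ∪ ⋂ n, ⋃₀ P n := by
    rintro x ⟨hx, hxQ⟩
    by_contra hcon
    simp only [mem_union, mem_iUnion, mem_iInter, Set.mem_sdiff, not_or, not_exists, not_and,
      not_not] at hcon hxQ
    refine hcon.2 fun n => ?_
    induction n with
    | zero => exact h.sUnion_zero.symm ▸ hx
    | succ n ih => exact hcon.1 n ih (hxQ n)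
  refine measure_mono_null hsub (measure_union_null (measure_iUnion_null fun n => (h.step n).null) ?_)
  have hle : ∀ n, volume (⋂ n, ⋃₀ P n) ≤ ENNReal.ofReal (∏ i ∈ Finset.range n, κ i) * volume Ω :=
    fun n => (measure_mono (iInter_subset _ n)).trans (h.volume_active hκ n).le
  have ht : Tendsto (fun n => ENNReal.ofReal (∏ i ∈ Finset.range n, κ i) * volume Ω) atTop
      (𝓝 0) := by
    have := ENNReal.Tendsto.mul_const (ENNReal.tendsto_ofReal hlim) (b := volume Ω) (.inr hΩ)
    simpa using this
  exact le_antisymm (ge_of_tendsto' ht hle) zero_le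

theorem eq_of_mem_done (h : IsStaircase Ω A b κ L S T η u P Q) {n m : ℕ} (hnm : n < m) {x : Plane}
    (hx : x ∈ ⋃₀ Q n) : u m x = u (n + 1) x := by
  induction m, hnm using Nat.le_induction with
  | base => rfl
  | succ m hm ih => rw [(h.step m).eq_of_notMem x (h.notMem_active hm hx), ih]

theorem eq_of_notMem (h : IsStaircase Ω A b κ L S T η u P Q) {x : Plane} (hx : x ∉ Ω) (n : ℕ) :
    u n x = affineMap A b x := by
  induction n with
  | zero => rw [h.map_zero]
  | succ n ih => rw [(h.step n).eq_of_notMem x fun hn => hx (h.active_subset n hn), ih]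

end IsStaircase

/-! ### Hölder estimates and the weak gradient of the limit -/

/-- Interpolation: a Lipschitz function that is small in sup norm is small in `C^α`. The threshold
depends only on `L`, so the tolerances of a staircase can be fixed before the maps are built. -/
theorem exists_holder_of_lipschitz (L : ℝ≥0) {α : ℝ≥0} (hα1 : α < 1) {η : ℝ} (hη : 0 < η) :
    ∃ ε : ℝ, 0 < ε ∧ ε ≤ η ∧ ∀ φ : Plane → Plane, LipschitzWith L φ → (∀ x, ‖φ x‖ ≤ ε) →
      ∀ x y, ‖φ x - φ y‖ ≤ η * ‖x - y‖ ^ (α : ℝ) := by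
  have hα1' : (0 : ℝ) < 1 - α := sub_pos.2 (by exact_mod_cast hα1)
  -- At distance `d` the Lipschitz bound stops being sufficient, since `(L + 1) d ^ (1 - α) = η`;
  -- beyond it the sup bound is used.
  set d : ℝ := (η / (L + 1)) ^ (1 / (1 - α : ℝ)) with hd
  have hd0 : 0 < d := by positivity
  refine ⟨min η (η * d ^ (α : ℝ) / 2), by positivity, min_le_left _ _, fun φ hφ hs x y => ?_⟩
  rcases le_or_gt d ‖x - y‖ with hxy | hxy
  · calc ‖φ x - φ y‖ ≤ ‖φ x‖ + ‖φ y‖ := norm_sub_le _ _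
      _ ≤ η * d ^ (α : ℝ) / 2 + η * d ^ (α : ℝ) / 2 :=
        add_le_add ((hs x).trans (min_le_right _ _)) ((hs y).trans (min_le_right _ _))
      _ = η * d ^ (α : ℝ) := add_halves _
      _ ≤ η * ‖x - y‖ ^ (α : ℝ) := by gcongr
  · rcases (norm_nonneg (x - y)).eq_or_lt with h0 | h0
    · rw [eq_comm, norm_eq_zero, sub_eq_zero] at h0
      rw [h0, sub_self, norm_zero]
      positivity
    have h1 : ‖x - y‖ = ‖x - y‖ ^ (1 - α : ℝ) * ‖x - y‖ ^ (α : ℝ) := by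
      rw [← Real.rpow_add h0, sub_add_cancel, Real.rpow_one]
    have h2 : ‖x - y‖ ^ (1 - α : ℝ) ≤ η / (L + 1) := by
      calc ‖x - y‖ ^ (1 - α : ℝ) ≤ d ^ (1 - α : ℝ) := by gcongr
        _ = η / (L + 1) := by
          rw [hd, ← Real.rpow_mul (by positivity), one_div_mul_cancel hα1'.ne', Real.rpow_one]
    rw [← dist_eq_norm]
    refine (hφ.dist_le_mul x y).trans ?_
    rw [dist_eq_norm]
    nth_rewrite 1 [h1]
    rw [← mul_assoc]
    gcongr
    calc (L : ℝ) * ‖x - y‖ ^ (1 - α : ℝ) ≤ (L + 1) * (η / (L + 1)) := by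
          gcongr
          linarith
      _ = η := by field_simp

/-- The Jacobian matrix, computed with line derivatives. -/
noncomputable def jacobian (u : Plane → Plane) (x : Plane) : Mat :=
  Matrix.of fun i j => lineDeriv ℝ (fun y => u y i) x (EuclideanSpace.single j (1 : ℝ))

theorem jacobian_eq_of_eqOn {U : Set Plane} (hU : IsOpen U) {u : Plane → Plane} {A : Mat}
    {b : Plane} (h : ∀ x ∈ U, u x = affineMap A b x) {x : Plane} (hx : x ∈ U) :
    jacobian u x = A := by
  ext i j
  rw [jacobian, Matrix.of_apply, lineDeriv_eq_of_eqOn hU (ξ := row A i) (b := b i) ?_ hx]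
  · exact (by rw [EuclideanSpace.inner_single_right]; simp :
      ⟪row A i, EuclideanSpace.single j (1 : ℝ)⟫ = row A i j)
  · intro y hy
    rw [h y hy, affineMap_apply]

theorem measurable_jacobian {u : Plane → Plane} (hu : Continuous u) (i j : Fin 2) :
    Measurable fun x => jacobian u x i j :=
  measurable_lineDeriv (f := fun y => u y i) (by fun_prop)

theorem stronglyMeasurable_jacobian {u : Plane → Plane} (hu : Continuous u) :
    StronglyMeasurable (jacobian u) := by
  have h : StronglyMeasurable fun x => ((fun i j => jacobian u x i j : Fin 2 → Fin 2 → ℝ)) :=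
    (measurable_pi_lambda _ fun i => measurable_pi_lambda _ fun j =>
      measurable_jacobian hu i j).stronglyMeasurable
  have hc : Continuous fun f : Fin 2 → Fin 2 → ℝ => (Matrix.of f : Mat) := continuous_id
  exact hc.comp_stronglyMeasurable h

theorem abs_apply_le_norm (A : Mat) (i j : Fin 2) : |A i j| ≤ ‖A‖ :=
  (PiLp.norm_apply_le (row A i) j).trans (norm_row_le A i)

theorem integral_jacobian_mul {u : Plane → Plane} {L : ℝ≥0} (hu : LipschitzWith L u)
    {Ω : Set Plane} {φ : Plane → ℝ} (hφ : IsTestFunction Ω φ) (i j : Fin 2) :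
    ∫ x in Ω, u x i * fderiv ℝ φ x (EuclideanSpace.single j 1) =
      - ∫ x in Ω, jacobian u x i j * φ x := by
  have hui : LipschitzWith L fun x => u x i := by
    refine LipschitzWith.of_dist_le_mul fun x y => ?_
    refine le_trans ?_ (hu.dist_le_mul x y)
    rw [dist_eq_norm, dist_eq_norm]
    exact PiLp.norm_apply_le (u x - u y) i
  obtain ⟨D, hD⟩ := ContDiff.lipschitzWith_of_hasCompactSupport hφ.hasCompactSupport hφ.contDiff
    (by simp)
  have h := LipschitzWith.integral_lineDeriv_mul_eq (μ := (volume : Measure Plane)) hui hD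
    hφ.hasCompactSupport (EuclideanSpace.single j 1)
  have hd : ∀ x, lineDeriv ℝ φ x (-EuclideanSpace.single j 1) =
      -fderiv ℝ φ x (EuclideanSpace.single j 1) := fun x => by
    rw [((hφ.contDiff.differentiable (by simp)) x).lineDeriv_eq_fderiv, map_neg]
  simp only [hd, neg_mul, integral_neg] at h
  have hφ0 : ∀ x, x ∉ Ω → φ x = 0 := fun x hx =>
    image_eq_zero_of_notMem_tsupport fun h => hx (hφ.tsupport_subset h)
  have hφ1 : ∀ x, x ∉ Ω → fderiv ℝ φ x = 0 := fun x hx =>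
    image_eq_zero_of_notMem_tsupport fun h =>
      hx (hφ.tsupport_subset (tsupport_fderiv_subset ℝ h))
  rw [setIntegral_eq_integral_of_forall_compl_eq_zero fun x hx => by rw [hφ1 x hx]; simp,
    setIntegral_eq_integral_of_forall_compl_eq_zero fun x hx => by rw [hφ0 x hx, mul_zero]]
  simp only [jacobian, Matrix.of_apply]
  rw [h, neg_neg]
  simp only [mul_comm]

theorem lipschitzWith_affineMap (A : Mat) (b : Plane) : ∃ L : ℝ≥0, LipschitzWith L (affineMap A b) := by
  refine ⟨‖(Matrix.toEuclideanLin A).toContinuousLinearMap‖₊, ?_⟩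
  have := ((Matrix.toEuclideanLin A).toContinuousLinearMap.lipschitz).add (LipschitzWith.const b)
  rwa [add_zero] at this

/-- The limit of a sequence of maps, as a telescoping series. -/
noncomputable def limitMap (u : ℕ → Plane → Plane) (x : Plane) : Plane :=
  u 0 x + ∑' n, (u (n + 1) x - u n x)

namespace IsStaircase

variable {Ω : Set Plane} {A : Mat} {b : Plane} {κ : ℕ → ℝ} {L : ℕ → ℝ≥0}
  {S T : ℕ → Set Mat} {η : ℕ → ℝ} {u : ℕ → Plane → Plane} {P Q : ℕ → Set (Set Plane)}

theorem exists_lipschitzWith (h : IsStaircase Ω A b κ L S T η u P Q) (n : ℕ) :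
    ∃ C : ℝ≥0, LipschitzWith C (u n) := by
  induction n with
  | zero => exact h.map_zero ▸ lipschitzWith_affineMap A b
  | succ n ih =>
    obtain ⟨C, hC⟩ := ih
    refine ⟨C + 4 * L n, ?_⟩
    simpa using hC.add (h.step n).lipschitz

theorem summable_sub (h : IsStaircase Ω A b κ L S T η u P Q) (hη : Summable η) (x : Plane) :
    Summable fun n => u (n + 1) x - u n x :=
  hη.of_norm_bounded fun n => (h.step n).small x

theorem tendsto_limitMap (h : IsStaircase Ω A b κ L S T η u P Q) (hη : Summable η) (x : Plane) :
    Tendsto (fun n => u n x) atTop (𝓝 (limitMap u x)) := by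
  refine (((h.summable_sub hη x).hasSum.tendsto_sum_nat).const_add (u 0 x)).congr fun n => ?_
  rw [Finset.sum_range_sub (fun n => u n x), add_sub_cancel]

theorem limitMap_eq_of_mem_done (h : IsStaircase Ω A b κ L S T η u P Q) (hη : Summable η) {n : ℕ}
    {x : Plane} (hx : x ∈ ⋃₀ Q n) : limitMap u x = u (n + 1) x := by
  refine tendsto_nhds_unique (h.tendsto_limitMap hη x) (tendsto_const_nhds.congr' ?_)
  filter_upwards [eventually_gt_atTop n] with m hm
  exact (h.eq_of_mem_done hm hx).symm

theorem limitMap_eq_of_notMem (h : IsStaircase Ω A b κ L S T η u P Q) (hη : Summable η)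
    {x : Plane} (hx : x ∉ Ω) : limitMap u x = affineMap A b x :=
  tendsto_nhds_unique (h.tendsto_limitMap hη x)
    (tendsto_const_nhds.congr fun n => (h.eq_of_notMem hx n).symm)

theorem norm_limitMap_sub_le (h : IsStaircase Ω A b κ L S T η u P Q) (hη : Summable η)
    (x : Plane) : ‖limitMap u x - affineMap A b x‖ ≤ ∑' n, η n := by
  rw [limitMap, h.map_zero, add_sub_cancel_left]
  exact tsum_of_norm_bounded hη.hasSum fun n => (h.step n).small x

theorem norm_sub_affineMap_le (h : IsStaircase Ω A b κ L S T η u P Q) (hη : Summable η)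
    (hη0 : ∀ n, 0 ≤ η n) (n : ℕ) (x : Plane) : ‖u n x - affineMap A b x‖ ≤ ∑' n, η n := by
  have hs : u n x - affineMap A b x = ∑ i ∈ Finset.range n, (u (i + 1) x - u i x) := by
    rw [Finset.sum_range_sub (fun n => u n x), h.map_zero]
  rw [hs]
  exact (norm_sum_le_of_le _ fun i _ => (h.step i).small x).trans
    (hη.sum_le_tsum _ fun i _ => hη0 i)

theorem holder_limitMap (h : IsStaircase Ω A b κ L S T η u P Q) (hη : Summable η) {α : ℝ}
    {θ : ℕ → ℝ} (hθ : Summable θ)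
    (hH : ∀ n x y, ‖(u (n + 1) x - u n x) - (u (n + 1) y - u n y)‖ ≤ θ n * ‖x - y‖ ^ α)
    (x y : Plane) :
    ‖(limitMap u x - affineMap A b x) - (limitMap u y - affineMap A b y)‖ ≤
      (∑' n, θ n) * ‖x - y‖ ^ α := by
  rw [limitMap, limitMap, h.map_zero, add_sub_cancel_left, add_sub_cancel_left,
    ← (h.summable_sub hη x).tsum_sub (h.summable_sub hη y), ← tsum_mul_right]
  exact tsum_of_norm_bounded (hθ.mul_right _).hasSum fun n => hH n x y

theorem continuous_limitMap (h : IsStaircase Ω A b κ L S T η u P Q) (hη : Summable η) :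
    Continuous (limitMap u) := by
  have hc : ∀ n, Continuous (u n) := fun n => (h.exists_lipschitzWith n).choose_spec.continuous
  exact (hc 0).add (continuous_tsum (fun n => (hc (n + 1)).sub (hc n)) hη fun n x => (h.step n).small x)

theorem jacobian_mem_of_mem_active (h : IsStaircase Ω A b κ L S T η u P Q) {n : ℕ} {x : Plane}
    (hx : x ∈ ⋃₀ P n) : jacobian (u n) x ∈ S n := by
  obtain ⟨V, hV, hx⟩ := hx
  obtain ⟨A, hA, b, hb⟩ := h.affine n V hV
  rwa [jacobian_eq_of_eqOn ((h.isPieceFamily n).regular V hV).isOpen hb hx]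

theorem jacobian_limitMap_mem (h : IsStaircase Ω A b κ L S T η u P Q) (hη : Summable η) {n : ℕ}
    {x : Plane} (hx : x ∈ ⋃₀ Q n) : jacobian (limitMap u) x ∈ T n := by
  obtain ⟨V, hV, hx⟩ := hx
  obtain ⟨A, hA, b, hb⟩ := (h.step n).affine_done V hV
  rwa [jacobian_eq_of_eqOn ((h.step n).done.regular V hV).isOpen (A := A) (b := b) (fun y hy => ?_) hx]
  rw [h.limitMap_eq_of_mem_done hη ⟨V, hV, hy⟩, hb y hy]

theorem jacobian_eq_of_mem_done (h : IsStaircase Ω A b κ L S T η u P Q) (hη : Summable η)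
    {n m : ℕ} (hnm : n < m) {x : Plane} (hx : x ∈ ⋃₀ Q n) :
    jacobian (u m) x = jacobian (limitMap u) x := by
  obtain ⟨V, hV, hx⟩ := hx
  obtain ⟨A, hA, b, hb⟩ := (h.step n).affine_done V hV
  have ho := ((h.step n).done.regular V hV).isOpen
  rw [jacobian_eq_of_eqOn ho (A := A) (b := b) (fun y hy => ?_) hx,
    jacobian_eq_of_eqOn ho (A := A) (b := b) (fun y hy => ?_) hx]
  · rw [h.limitMap_eq_of_mem_done hη ⟨V, hV, hy⟩, hb y hy]
  · rw [h.eq_of_mem_done hnm ⟨V, hV, hy⟩, hb y hy]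

theorem isPieceFamily_iUnion_done (h : IsStaircase Ω A b κ L S T η u P Q) :
    IsPieceFamily (⋃ n, Q n) :=
  IsPieceFamily.iUnion h.disjoint_done (fun n => (h.step n).done) fun _ => Subset.rfl

theorem isPiecewiseAffine_limitMap (h : IsStaircase Ω A b κ L S T η u P Q) (hη : Summable η)
    (hnull : volume (Ω \ ⋃ n, ⋃₀ Q n) = 0) : IsPiecewiseAffine Ω (limitMap u) := by
  have hF := h.isPieceFamily_iUnion_done
  refine ⟨⋃ n, Q n, hF.countable, hF.disjoint, fun V hV => ⟨hF.regular V hV, ?_⟩,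
    by rwa [sUnion_iUnion], fun V hV => ?_⟩
  · obtain ⟨n, hn⟩ := mem_iUnion.1 hV
    exact (subset_sUnion_of_mem hn).trans (h.done_subset n)
  · obtain ⟨n, hn⟩ := mem_iUnion.1 hV
    obtain ⟨A, -, b, hb⟩ := (h.step n).affine_done V hn
    exact ⟨A, b, fun x hx => by rw [h.limitMap_eq_of_mem_done hη ⟨V, hn, hx⟩, hb x hx]⟩

theorem ae_restrict_mem_done (h : IsStaircase Ω A b κ L S T η u P Q)
    (hnull : volume (Ω \ ⋃ n, ⋃₀ Q n) = 0) : ∀ᵐ x ∂volume.restrict Ω, x ∈ ⋃ n, ⋃₀ Q n := by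
  have ho : IsOpen (⋃ n, ⋃₀ Q n) := isOpen_iUnion fun n => (h.step n).done.isOpen_sUnion
  rw [ae_iff]
  change (volume.restrict Ω) (⋃ n, ⋃₀ Q n)ᶜ = 0
  rw [Measure.restrict_apply ho.measurableSet.compl, inter_comm]
  exact hnull

/-- The sum of the gradient bounds over the levels reached by a point. -/
noncomputable def majorant (P : ℕ → Set (Set Plane)) (N : ℕ → ℝ≥0) (x : Plane) : ℝ≥0∞ :=
  ∑' n, (⋃₀ P n).indicator (fun _ => (N n : ℝ≥0∞)) x

theorem le_majorant {N : ℕ → ℝ≥0} {n : ℕ} {x : Plane} (hx : x ∈ ⋃₀ P n) :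
    (N n : ℝ≥0∞) ≤ majorant P N x :=
  (indicator_of_mem hx fun _ => (N n : ℝ≥0∞)).symm.le.trans
    (ENNReal.le_tsum (f := fun n => (⋃₀ P n).indicator (fun _ => (N n : ℝ≥0∞)) x) n)

theorem measurable_majorant (h : IsStaircase Ω A b κ L S T η u P Q) (N : ℕ → ℝ≥0) :
    Measurable (majorant P N) :=
  Measurable.tsum fun n => measurable_const.indicator (h.isPieceFamily n).isOpen_sUnion.measurableSet

theorem lintegral_majorant (h : IsStaircase Ω A b κ L S T η u P Q) (N : ℕ → ℝ≥0) :
    ∫⁻ x, majorant P N x = ∑' n, N n * volume (⋃₀ P n) := by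
  unfold majorant
  have hm := fun n => (h.isPieceFamily n).isOpen_sUnion.measurableSet
  rw [lintegral_tsum fun n => (measurable_const.indicator (hm n)).aemeasurable]
  exact tsum_congr fun n => by rw [lintegral_indicator (hm n), setLIntegral_const]

/-- At step `m` a point is either already finished, with its final gradient, or still active. In
both cases a single term of the majorant bounds the gradient, so the bound is uniform in `m`. -/
theorem enorm_jacobian_le (h : IsStaircase Ω A b κ L S T η u P Q) (hη : Summable η) {N : ℕ → ℝ≥0}
    (hS : ∀ n, ∀ C ∈ S n, ‖C‖ ≤ N n) (hT : ∀ n, ∀ C ∈ T n, ‖C‖ ≤ N n) {x : Plane}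
    (hx : x ∈ ⋃ n, ⋃₀ Q n) (m : ℕ) : ‖jacobian (u m) x‖ₑ ≤ majorant P N x := by
  obtain ⟨n, hn⟩ := mem_iUnion.1 hx
  have hle : ∀ {C : Mat} {k : ℕ}, ‖C‖ ≤ N k → ‖C‖ₑ ≤ N k := fun hC => by
    rw [← ofReal_norm]
    exact ENNReal.ofReal_le_of_le_toReal (by simpa using hC)
  rcases lt_or_ge n m with hnm | hnm
  · rw [h.jacobian_eq_of_mem_done hη hnm hn]
    exact (hle (hT n _ (h.jacobian_limitMap_mem hη hn))).trans
      (le_majorant ((h.step n).done_subset hn))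
  · have hm := h.antitone hnm ((h.step n).done_subset hn)
    exact (hle (hS m _ (h.jacobian_mem_of_mem_active hm))).trans (le_majorant hm)

theorem lintegral_jacobian_rpow_le (h : IsStaircase Ω A b κ L S T η u P Q) (hη : Summable η)
    {N : ℕ → ℝ≥0} (hT : ∀ n, ∀ C ∈ T n, ‖C‖ ≤ N n) (hnull : volume (Ω \ ⋃ n, ⋃₀ Q n) = 0)
    {q : ℝ} (hq : 0 ≤ q) :
    ∫⁻ x in Ω, ‖jacobian (limitMap u) x‖ₑ ^ q ≤ ∑' n, (N n : ℝ≥0∞) ^ q * volume (⋃₀ P n) := by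
  have hle : ∀ᵐ x ∂volume.restrict Ω, ‖jacobian (limitMap u) x‖ₑ ^ q ≤ majorant P (fun n => N n ^ q) x := by
    filter_upwards [h.ae_restrict_mem_done hnull] with x hx
    obtain ⟨n, hn⟩ := mem_iUnion.1 hx
    refine le_trans ?_ (le_majorant ((h.step n).done_subset hn))
    rw [ENNReal.coe_rpow_of_nonneg _ hq]
    gcongr
    rw [← ofReal_norm]
    exact ENNReal.ofReal_le_of_le_toReal (by simpa using hT n _ (h.jacobian_limitMap_mem hη hn))
  refine (lintegral_mono_ae hle).trans ((setLIntegral_le_lintegral _ _).trans ?_)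
  rw [h.lintegral_majorant]
  simp only [ENNReal.coe_rpow_of_nonneg _ hq, le_refl]

theorem memLp_jacobian (h : IsStaircase Ω A b κ L S T η u P Q) (hη : Summable η)
    {N : ℕ → ℝ≥0} (hT : ∀ n, ∀ C ∈ T n, ‖C‖ ≤ N n) (hnull : volume (Ω \ ⋃ n, ⋃₀ Q n) = 0)
    {q : ℝ} (hq : 0 < q) (hfin : ∑' n, (N n : ℝ≥0∞) ^ q * volume (⋃₀ P n) ≠ ⊤) :
    MemLp (jacobian (limitMap u)) (ENNReal.ofReal q) (volume.restrict Ω) := by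
  refine ⟨(stronglyMeasurable_jacobian (h.continuous_limitMap hη)).aestronglyMeasurable, ?_⟩
  rw [eLpNorm_lt_top_iff_lintegral_rpow_enorm_lt_top (by simpa using hq) (by simp),
    ENNReal.toReal_ofReal hq.le]
  exact (h.lintegral_jacobian_rpow_le hη hT hnull hq.le).trans_lt hfin.lt_top

/-- Each `u n` is Lipschitz and can be integrated by parts. Both sides converge by dominated
convergence: the maps are uniformly close to the affine map, and the Jacobians are eventually
constant at almost every point and dominated by `majorant P N`. -/
theorem isWeakGradient_limitMap (h : IsStaircase Ω A b κ L S T η u P Q)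
    (hη : Summable η) (hη0 : ∀ n, 0 ≤ η n) {N : ℕ → ℝ≥0} (hS : ∀ n, ∀ C ∈ S n, ‖C‖ ≤ N n)
    (hT : ∀ n, ∀ C ∈ T n, ‖C‖ ≤ N n) (hnull : volume (Ω \ ⋃ n, ⋃₀ Q n) = 0)
    (hfin : ∑' n, (N n : ℝ≥0∞) * volume (⋃₀ P n) ≠ ⊤) :
    IsWeakGradient Ω (limitMap u) (jacobian (limitMap u)) := by
  have hcont := h.continuous_limitMap hη
  have hG := h.memLp_jacobian hη hT hnull (q := 1) one_pos (by simpa using hfin)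
  rw [ENNReal.ofReal_one] at hG
  intro i j
  have hGij : IntegrableOn (fun x => jacobian (limitMap u) x i j) Ω :=
    memLp_one_iff_integrable.1 (hG.mono (measurable_jacobian hcont i j).aestronglyMeasurable
      (.of_forall fun x => abs_apply_le_norm _ i j))
  refine ⟨(Continuous.locallyIntegrable (by fun_prop)).locallyIntegrableOn Ω, hGij.locallyIntegrableOn,
    fun φ hφ => ?_⟩
  have hun : ∀ n, Continuous (u n) := fun n => (h.exists_lipschitzWith n).choose_spec.continuous
  have hφc : Continuous φ := hφ.contDiff.continuous
  have hφd : Continuous fun x => fderiv ℝ φ x (EuclideanSpace.single j 1) :=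
    (hφ.contDiff.continuous_fderiv (by simp)).clm_apply continuous_const
  have hφdc : HasCompactSupport fun x => fderiv ℝ φ x (EuclideanSpace.single j 1) :=
    (hφ.hasCompactSupport.fderiv_apply (𝕜 := ℝ) _)
  have haff : Continuous (affineMap A b) := (lipschitzWith_affineMap A b).choose_spec.continuous
  have h1 : Tendsto (fun n => ∫ x in Ω, u n x i * fderiv ℝ φ x (EuclideanSpace.single j 1)) atTop
      (𝓝 (∫ x in Ω, limitMap u x i * fderiv ℝ φ x (EuclideanSpace.single j 1))) := by
    refine tendsto_integral_of_dominated_convergence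
      (fun x => (‖affineMap A b x‖ + ∑' n, η n) * ‖fderiv ℝ φ x (EuclideanSpace.single j 1)‖)
      (fun n => ?_) ?_ (fun n => ?_) (.of_forall fun x => ?_)
    · have := hun n
      exact Continuous.aestronglyMeasurable (by fun_prop)
    · refine (Continuous.integrable_of_hasCompactSupport (by fun_prop) ?_).integrableOn
      exact hφdc.norm.mul_left
    · refine .of_forall fun x => ?_
      rw [norm_mul]
      gcongr
      refine (PiLp.norm_apply_le (u n x) i).trans ?_
      have := h.norm_sub_affineMap_le hη hη0 n x
      linarith [norm_le_norm_add_norm_sub' (u n x) (affineMap A b x)]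
    · have := h.tendsto_limitMap hη x
      exact (((EuclideanSpace.proj (𝕜 := ℝ) i).continuous.tendsto _).comp this).mul_const _
  have h2 : Tendsto (fun n => ∫ x in Ω, jacobian (u n) x i j * φ x) atTop
      (𝓝 (∫ x in Ω, jacobian (limitMap u) x i j * φ x)) := by
    obtain ⟨M, hM⟩ := hφ.hasCompactSupport.exists_bound_of_continuous hφc
    have hmaj : ∫⁻ x in Ω, majorant P N x ≠ ⊤ :=
      ne_top_of_le_ne_top (h.lintegral_majorant N ▸ hfin) (setLIntegral_le_lintegral _ _)
    refine tendsto_integral_of_dominated_convergence (fun x => (majorant P N x).toReal * M)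
      (fun n => ?_) ?_ (fun n => ?_) ?_
    · exact ((measurable_jacobian (hun n) i j).mul hφc.measurable).aestronglyMeasurable
    · exact (integrable_toReal_of_lintegral_ne_top (h.measurable_majorant N).aemeasurable hmaj).mul_const _
    · filter_upwards [h.ae_restrict_mem_done hnull,
        ae_lt_top (h.measurable_majorant N) hmaj] with x hx hx'
      rw [norm_mul]
      gcongr
      · refine (abs_apply_le_norm _ i j).trans ?_
        have := ENNReal.toReal_mono hx'.ne (h.enorm_jacobian_le hη hS hT hx n)
        rwa [toReal_enorm] at this
      · exact hM x
    · filter_upwards [h.ae_restrict_mem_done hnull] with x hx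
      obtain ⟨n, hn⟩ := mem_iUnion.1 hx
      refine tendsto_const_nhds.congr' ?_
      filter_upwards [eventually_gt_atTop n] with m hm
      rw [h.jacobian_eq_of_mem_done hη hm hn]
  refine tendsto_nhds_unique h1 (h2.neg.congr fun n => ?_)
  obtain ⟨C, hC⟩ := h.exists_lipschitzWith n
  exact (integral_jacobian_mul hC hφ i j).symm

end IsStaircase

/-! ### The planar geometry of one split -/

theorem exists_pos_norm_add_smul_eq {m d : Plane} (hd : d ≠ 0) {X : ℝ} (hm : ‖m‖ < X) :
    ∃ t : ℝ, 0 < t ∧ ‖m + t • d‖ = X := by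
  have hd' : 0 < ‖d‖ := norm_pos_iff.2 hd
  set τ : ℝ := (X + ‖m‖) / ‖d‖ with hτ
  have hτ0 : 0 ≤ τ := div_nonneg (by linarith [norm_nonneg m]) hd'.le
  have hc : ContinuousOn (fun t : ℝ => ‖m + t • d‖) (Icc 0 τ) := by fun_prop
  have hX : X ∈ Icc ‖m + (0 : ℝ) • d‖ ‖m + τ • d‖ := by
    refine ⟨by simpa using hm.le, ?_⟩
    have h1 : ‖τ • d‖ = X + ‖m‖ := by
      rw [norm_smul, Real.norm_of_nonneg hτ0, hτ, div_mul_cancel₀ _ hd'.ne']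
    have h2 := norm_sub_norm_le (τ • d) (-m)
    rw [norm_neg, sub_neg_eq_add, add_comm (τ • d)] at h2
    linarith
  obtain ⟨t, ht, htX⟩ := intermediate_value_Icc hτ0 hc hX
  refine ⟨t, ht.1.lt_of_ne ?_, htX⟩
  rintro rfl
  simp only [zero_smul, add_zero] at htX
  exact hm.ne htX

/-- Rotation by a right angle. -/
noncomputable def rot (n : Plane) : Plane := !₂[-n 1, n 0]

theorem inner_rot_self (n : Plane) : ⟪n, rot n⟫ = 0 := by
  simp [rot, PiLp.inner_apply]
  ring

theorem inner_sq_add_inner_rot_sq (n y : Plane) :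
    ⟪n, y⟫ ^ 2 + ⟪rot n, y⟫ ^ 2 = ‖n‖ ^ 2 * ‖y‖ ^ 2 := by
  rw [EuclideanSpace.norm_sq_eq, EuclideanSpace.norm_sq_eq]
  simp [rot, PiLp.inner_apply]
  ring

theorem norm_rot (n : Plane) : ‖rot n‖ = ‖n‖ := by
  rw [← sq_eq_sq₀ (norm_nonneg _) (norm_nonneg _), EuclideanSpace.norm_sq_eq, EuclideanSpace.norm_sq_eq]
  simp [rot]
  ring

/-- The splitting step: the `i`-th row is replaced by `k` with weight `1 - β` and by two vectors
of length `X` with total weight `β`. -/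
theorem splits_of_row {C : Mat} {i : Fin 2} {k : Plane} {β X : ℝ} {S T : Set Mat} {L : ℝ≥0}
    (hβ0 : 0 < β) (hβ1 : β < 1) (hk : k ≠ row C i) (hX : ‖row C i‖ + (1 - β) * ‖k‖ < β * X)
    (hT : setRow C i k ∈ T) (hS : ∀ z, ‖z‖ = X → setRow C i z ∈ S)
    (hLk : ‖k‖ + ‖row C i‖ ≤ L) (hLX : X + ‖row C i‖ ≤ L) : Splits β L C T S := by
  set z₀ := row C i with hz₀
  set n := z₀ - k with hn
  have hn0 : n ≠ 0 := sub_ne_zero.2 hk.symm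
  have hnn : 0 < ‖n‖ ^ 2 := by
    have := norm_pos_iff.2 hn0
    positivity
  have hr0 : rot n ≠ 0 := by
    rw [← norm_pos_iff, norm_rot, norm_pos_iff]
    exact hn0
  -- The point `z₀ + γ n = (z₀ - (1 - β) k) / β` is the one whose average with `k`, at weights `β`
  -- and `1 - β`, is `z₀`. By `hX` it lies inside the circle of radius `X`, so the line through it
  -- orthogonal to `n` meets the circle on both sides; these are the other two vertices.
  set γ : ℝ := (1 - β) / β with hγ
  have hγ0 : 0 < γ := div_pos (by linarith) hβ0
  have hγβ : γ * β = 1 - β := div_mul_cancel₀ _ hβ0.ne'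
  have hm : ‖z₀ + γ • n‖ < X := by
    have h1 : z₀ + γ • n = β⁻¹ • (z₀ - (1 - β) • k) := by
      rw [hn, hγ]
      match_scalars
      · field_simp
        ring
      · field_simp
    rw [h1, norm_smul, norm_inv, Real.norm_of_nonneg hβ0.le, inv_mul_lt_iff₀ hβ0]
    refine lt_of_le_of_lt ((norm_sub_le _ _).trans_eq ?_) hX
    rw [norm_smul, Real.norm_of_nonneg (by linarith)]
  obtain ⟨t, ht0, ht⟩ := exists_pos_norm_add_smul_eq (neg_ne_zero.2 hr0) hm
  obtain ⟨s, hs0, hs⟩ := exists_pos_norm_add_smul_eq hr0 hm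
  rw [smul_neg, ← neg_smul] at ht
  have h1 : z₀ + (γ • n + -t • rot n) = z₀ + γ • n + -t • rot n := by abel
  have h2 : z₀ + (γ • n + s • rot n) = z₀ + γ • n + s • rot n := by abel
  have h0 : z₀ + -n = k := by rw [hn]; abel
  have hrn : ⟪rot n, n⟫ = 0 := by rw [real_inner_comm, inner_rot_self]
  have hle : ∀ {ξ : Plane}, ‖z₀ + ξ‖ = X → ‖ξ‖ ≤ L := fun {ξ} h => by
    have := norm_sub_le (z₀ + ξ) z₀
    rw [add_sub_cancel_left] at this
    linarith
  have hν0 : ⟪-n, (β / ‖n‖ ^ 2) • n⟫ = -β := by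
    rw [inner_neg_left, inner_smul_right, real_inner_self_eq_norm_sq, div_mul_cancel₀ _ hnn.ne']
  have hν1 : ∀ r : ℝ, ⟪γ • n + r • rot n, (β / ‖n‖ ^ 2) • n⟫ = 1 - β := fun r => by
    rw [inner_smul_right, inner_add_left, real_inner_smul_left, real_inner_smul_left, hrn,
      real_inner_self_eq_norm_sq, ← hγβ]
    field_simp
    ring
  have hne : ∀ r : ℝ, -n ≠ γ • n + r • rot n := fun r h => by
    have := hν1 r
    rw [← h, hν0] at this
    linarith
  have hne' : γ • n + -t • rot n ≠ γ • n + s • rot n := fun h => by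
    rw [add_right_inj] at h
    have := smul_left_injective ℝ hr0 h
    linarith
  refine ⟨i, ![-n, γ • n + -t • rot n, γ • n + s • rot n], (β / ‖n‖ ^ 2) • n, ?_, ?_, ?_, hν0,
    hν1 _, hν1 _, ?_, ?_⟩
  · intro y hy
    rcases lt_or_ge 0 ⟪n, y⟫ with ha | ha
    · exact ⟨0, by simpa using ha⟩
    have hin : ∀ r : ℝ, ⟪γ • n + r • rot n, y⟫ = γ * ⟪n, y⟫ + r * ⟪rot n, y⟫ := fun r => by
      rw [inner_add_left, real_inner_smul_left, real_inner_smul_left]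
    have hγa := mul_nonpos_of_nonneg_of_nonpos hγ0.le ha
    rcases lt_trichotomy 0 ⟪rot n, y⟫ with hb | hb | hb
    · refine ⟨1, ?_⟩
      change ⟪γ • n + -t • rot n, y⟫ < 0
      rw [hin]
      linarith [mul_pos ht0 hb]
    · refine ⟨1, ?_⟩
      change ⟪γ • n + -t • rot n, y⟫ < 0
      rw [hin, ← hb, mul_zero, add_zero]
      -- If `y` were orthogonal to both `n` and `rot n`, it would vanish.
      refine mul_neg_of_pos_of_neg hγ0 (ha.lt_of_ne fun h => ?_)
      have := inner_sq_add_inner_rot_sq n y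
      rw [h, ← hb] at this
      have hy' : 0 < ‖y‖ ^ 2 := by
        have := norm_pos_iff.2 hy
        positivity
      linarith [mul_pos hnn hy']
    · refine ⟨2, ?_⟩
      change ⟪γ • n + s • rot n, y⟫ < 0
      rw [hin]
      linarith [mul_neg_of_pos_of_neg hs0 hb]
  · intro a b hab
    fin_cases a <;> fin_cases b
    · rfl
    · exact absurd hab (hne _)
    · exact absurd hab (hne _)
    · exact absurd hab.symm (hne _)
    · rfl
    · exact absurd hab hne'
    · exact absurd hab.symm (hne _)
    · exact absurd hab.symm hne'
    · rfl
  · intro j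
    fin_cases j
    · change ‖-n‖ ≤ L
      rw [norm_neg, hn]
      linarith [norm_sub_le z₀ k]
    · exact hle (h1 ▸ ht)
    · exact hle (h2 ▸ hs)
  · change setRow C i (z₀ + -n) ∈ T
    rwa [h0]
  · intro j hj
    fin_cases j
    · exact absurd rfl hj
    · exact hS _ (h1 ▸ ht)
    · exact hS _ (h2 ▸ hs)

/-! ### The rows of matrices in `K p` -/

theorem mem_K_of_apply {p l c s : ℝ} (hl : 0 ≤ l) (hcs : c ^ 2 + s ^ 2 = 1) {C : Mat}
    (h00 : C 0 0 = l * c) (h01 : C 0 1 = -(l * s)) (h10 : C 1 0 = l ^ (p - 1) * s)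
    (h11 : C 1 1 = l ^ (p - 1) * c) : C ∈ K p := by
  refine ⟨l, hl, !![c, -s; s, c], ?_, ?_⟩
  · rw [Matrix.mem_specialOrthogonalGroup_iff, Matrix.mem_orthogonalGroup_iff]
    constructor
    · ext i j
      fin_cases i <;> fin_cases j <;> simp [Matrix.mul_apply, Fin.sum_univ_two] <;> linarith
    · rw [Matrix.det_fin_two_of]
      linarith
  · ext i j
    fin_cases i <;> fin_cases j <;> simp [Matrix.mul_apply, Fin.sum_univ_two, h00, h01, h10, h11]

theorem exists_apply_of_mem_K {p : ℝ} {C : Mat} (hC : C ∈ K p) : ∃ l c s : ℝ, 0 ≤ l ∧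
    c ^ 2 + s ^ 2 = 1 ∧ C 0 0 = l * c ∧ C 0 1 = -(l * s) ∧ C 1 0 = l ^ (p - 1) * s ∧
      C 1 1 = l ^ (p - 1) * c := by
  obtain ⟨l, hl, R, hR, rfl⟩ := hC
  rw [Matrix.mem_specialOrthogonalGroup_iff, Matrix.mem_orthogonalGroup_iff, Matrix.det_fin_two] at hR
  obtain ⟨hO, hdet⟩ := hR
  have e00 := congrFun (congrFun hO 0) 0
  have e11 := congrFun (congrFun hO 1) 1
  simp [Matrix.mul_apply, Fin.sum_univ_two] at e00 e11
  -- The left side is the sum of the squared row lengths minus twice the determinant, that is, `2 -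
  -- 2`.
  have hsq : (R 0 0 - R 1 1) ^ 2 + (R 0 1 + R 1 0) ^ 2 = 0 := by linarith
  have ha : R 0 0 = R 1 1 := by nlinarith [sq_nonneg (R 0 0 - R 1 1), sq_nonneg (R 0 1 + R 1 0)]
  have hb : R 0 1 = -R 1 0 := by nlinarith [sq_nonneg (R 0 0 - R 1 1), sq_nonneg (R 0 1 + R 1 0)]
  refine ⟨l, R 1 1, R 1 0, hl, by linarith, ?_, ?_, ?_, ?_⟩ <;>
    simp [Matrix.mul_apply, Fin.sum_univ_two, ha, hb]

theorem norm_rows_of_mem_K {p : ℝ} {C : Mat} (hC : C ∈ K p) : ‖row C 1‖ = ‖row C 0‖ ^ (p - 1) := by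
  obtain ⟨l, c, s, hl, hcs, h00, h01, h10, h11⟩ := exists_apply_of_mem_K hC
  have e0 : ‖row C 0‖ = l := by
    rw [← sq_eq_sq₀ (norm_nonneg _) hl, EuclideanSpace.norm_sq_eq, Fin.sum_univ_two]
    simp only [row_apply, h00, h01, Real.norm_eq_abs, sq_abs]
    linear_combination l ^ 2 * hcs
  rw [e0, ← sq_eq_sq₀ (norm_nonneg _) (by positivity), EuclideanSpace.norm_sq_eq, Fin.sum_univ_two]
  simp only [row_apply, h10, h11, Real.norm_eq_abs, sq_abs]
  linear_combination (l ^ (p - 1)) ^ 2 * hcs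

/-- On `K p` the second row is the rotated flux of the first one. -/
theorem flux_of_mem_K {p : ℝ} (hp : 1 < p) {C : Mat} (hC : C ∈ K p) :
    ‖row C 0‖ ^ (p - 2) • row C 0 = !₂[C 1 1, -C 1 0] := by
  obtain ⟨l, c, s, hl, hcs, h00, h01, h10, h11⟩ := exists_apply_of_mem_K hC
  have e0 : ‖row C 0‖ = l := by
    rw [← sq_eq_sq₀ (norm_nonneg _) hl, EuclideanSpace.norm_sq_eq, Fin.sum_univ_two]
    simp only [row_apply, h00, h01, Real.norm_eq_abs, sq_abs]
    linear_combination l ^ 2 * hcs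
  have hpow : l ^ (p - 2) * l = l ^ (p - 1) := by
    rcases hl.eq_or_lt with rfl | hl
    · rw [mul_zero, Real.zero_rpow (by linarith)]
    · rw [← Real.rpow_add_one hl.ne']
      ring_nf
  ext j
  fin_cases j
  · simp [e0, h00, h11, ← hpow]
    ring
  · simp [e0, h01, h10, ← hpow]
    ring

/-- A nonzero second row of length `l ^ (p - 1)` determines the rotation, and with it the first row
that completes the matrix in `K p`. -/
theorem exists_setRow_zero_mem_K {p l : ℝ} (hl : 0 < l) {C : Mat} (hC : ‖row C 1‖ = l ^ (p - 1)) :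
    ∃ k : Plane, ‖k‖ = l ∧ setRow C 0 k ∈ K p := by
  set r := l ^ (p - 1) with hr
  have hr0 : 0 < r := by positivity
  have hcs : (C 1 1 / r) ^ 2 + (C 1 0 / r) ^ 2 = 1 := by
    have := EuclideanSpace.norm_sq_eq (row C 1)
    rw [hC, Fin.sum_univ_two] at this
    simp only [row_apply, Real.norm_eq_abs, sq_abs] at this
    rw [div_pow, div_pow, ← add_div, this, add_comm, div_self]
    rw [← this]
    positivity
  have hK : setRow C 0 !₂[l * (C 1 1 / r), -(l * (C 1 0 / r))] ∈ K p := by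
    refine mem_K_of_apply hl.le hcs ?_ ?_ ?_ ?_
    · simp [setRow]
    · simp [setRow]
    · rw [← hr, mul_div_cancel₀ _ hr0.ne']
      simp [setRow, Matrix.updateRow_apply]
    · rw [← hr, mul_div_cancel₀ _ hr0.ne']
      simp [setRow, Matrix.updateRow_apply]
  refine ⟨_, ?_, hK⟩
  rw [← sq_eq_sq₀ (norm_nonneg _) hl.le, EuclideanSpace.norm_sq_eq, Fin.sum_univ_two]
  simp only [Real.norm_eq_abs, sq_abs, Matrix.cons_val_zero, Matrix.cons_val_one]
  linear_combination l ^ 2 * hcs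

theorem exists_setRow_one_mem_K {p l : ℝ} (hl : 0 < l) {C : Mat} (hC : ‖row C 0‖ = l) :
    ∃ k : Plane, ‖k‖ = l ^ (p - 1) ∧ setRow C 1 k ∈ K p := by
  have hcs : (C 0 0 / l) ^ 2 + (-(C 0 1 / l)) ^ 2 = 1 := by
    have := EuclideanSpace.norm_sq_eq (row C 0)
    rw [hC, Fin.sum_univ_two] at this
    simp only [row_apply, Real.norm_eq_abs, sq_abs] at this
    rw [neg_sq, div_pow, div_pow, ← add_div, this, div_self]
    rw [← this]
    positivity
  have hK : setRow C 1 !₂[l ^ (p - 1) * -(C 0 1 / l), l ^ (p - 1) * (C 0 0 / l)] ∈ K p := by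
    refine mem_K_of_apply hl.le hcs ?_ ?_ ?_ ?_
    · rw [mul_div_cancel₀ _ hl.ne']
      simp [setRow, Matrix.updateRow_apply]
    · simp [setRow, Matrix.updateRow_apply]
      field_simp
    · simp [setRow]
    · simp [setRow]
  refine ⟨_, ?_, hK⟩
  have h := norm_rows_of_mem_K hK
  rwa [row_setRow_self, row_setRow_of_ne _ (by decide), hC] at h

/-! ### From the inclusion to the `p`-Laplace equation -/

theorem IsTestFunction.fderiv_apply {Ω : Set Plane} {φ : Plane → ℝ} (hφ : IsTestFunction Ω φ)
    (v : Plane) : IsTestFunction Ω fun x => fderiv ℝ φ x v where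
  contDiff := (hφ.contDiff.fderiv_right (by simp)).clm_apply contDiff_const
  hasCompactSupport := hφ.hasCompactSupport.fderiv_apply (𝕜 := ℝ) v
  tsupport_subset := (tsupport_fderiv_apply_subset ℝ v).trans hφ.tsupport_subset

theorem IsTestFunction.fderiv_fderiv_comm {Ω : Set Plane} {φ : Plane → ℝ}
    (hφ : IsTestFunction Ω φ) (v w x : Plane) :
    fderiv ℝ (fun y => fderiv ℝ φ y v) x w = fderiv ℝ (fun y => fderiv ℝ φ y w) x v := by
  have hd : DifferentiableAt ℝ (fderiv ℝ φ) x :=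
    ((hφ.contDiff.fderiv_right (m := ∞) (by simp)).differentiable (by simp)) x
  have hsymm : IsSymmSndFDerivAt ℝ φ x :=
    (hφ.contDiff.contDiffAt).isSymmSndFDerivAt (by simpa using ENat.LEInfty.out)
  rw [fderiv_clm_apply hd (differentiableAt_const _), fderiv_clm_apply hd (differentiableAt_const _)]
  simpa using hsymm w v

/-- The flux is the rotated weak gradient of the second component. Testing that gradient with the
derivatives of `φ` leaves the difference of the two mixed second derivatives, which is 0. -/
theorem isVeryWeakPLaplaceSolution_of_mem_K {p : ℝ} (hp : 1 < p) {Ω : Set Plane}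
    {u : Plane → Plane} {G : Plane → Mat} (hu : IsWeakGradient Ω u G)
    (hG : ∀ i j, IntegrableOn (fun x => G x i j) Ω)
    (hK : ∀ᵐ x ∂volume.restrict Ω, G x ∈ K p) :
    IsVeryWeakPLaplaceSolution p Ω fun x => u x 0 := by
  have hflux : (fun x => ‖row (G x) 0‖ ^ (p - 2) • row (G x) 0) =ᵐ[volume.restrict Ω]
      fun x => G x 1 1 • EuclideanSpace.single 0 (1 : ℝ) - G x 1 0 • EuclideanSpace.single 1 (1 : ℝ) := by
    filter_upwards [hK] with x hx
    rw [flux_of_mem_K hp hx]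
    ext j
    fin_cases j <;> simp
  refine ⟨fun x => row (G x) 0, fun j => hu 0 j, IntegrableOn.locallyIntegrableOn ?_, fun φ hφ => ?_⟩
  · exact (Integrable.sub ((hG 1 1).smul_const _) ((hG 1 0).smul_const _)).congr hflux.symm
  · have hint : ∀ (j k : Fin 2), IntegrableOn
        (fun x => G x 1 j * fderiv ℝ φ x (EuclideanSpace.single k (1 : ℝ))) Ω := by
      intro j k
      have ht := hφ.fderiv_apply (EuclideanSpace.single k (1 : ℝ))
      obtain ⟨M, hM⟩ := ht.hasCompactSupport.exists_bound_of_continuous ht.contDiff.continuous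
      exact (hG 1 j).mul_bdd (c := M) ht.contDiff.continuous.aestronglyMeasurable (.of_forall hM)
    have h1 := (hu 1 1).integral_eq _ (hφ.fderiv_apply (EuclideanSpace.single 0 (1 : ℝ)))
    have h0 := (hu 1 0).integral_eq _ (hφ.fderiv_apply (EuclideanSpace.single 1 (1 : ℝ)))
    calc ∫ x in Ω, fderiv ℝ φ x (‖row (G x) 0‖ ^ (p - 2) • row (G x) 0)
        = ∫ x in Ω, (G x 1 1 * fderiv ℝ φ x (EuclideanSpace.single 0 (1 : ℝ)) -
            G x 1 0 * fderiv ℝ φ x (EuclideanSpace.single 1 (1 : ℝ))) := by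
          refine integral_congr_ae ?_
          filter_upwards [hflux] with x hx
          rw [hx, map_sub, map_smul, map_smul, smul_eq_mul, smul_eq_mul]
      _ = 0 := by
          rw [integral_sub (hint 1 0) (hint 0 1)]
          simp only [hφ.fderiv_fderiv_comm (EuclideanSpace.single 0 (1 : ℝ))
            (EuclideanSpace.single 1 (1 : ℝ))] at h1
          linarith

/-! ### Hölder norms and integrability on bounded sets -/

theorem holderNormOn_le {α : ℝ≥0} {S : Set Plane} {f : Plane → Plane} {a c : ℝ} (hc : 0 ≤ c)
    (hf : ∀ x ∈ S, ‖f x‖ ≤ a) (hH : ∀ x ∈ S, ∀ y ∈ S, ‖f x - f y‖ ≤ c * ‖x - y‖ ^ (α : ℝ)) :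
    holderNormOn α S f ≤ ENNReal.ofReal a + ENNReal.ofReal c := by
  refine add_le_add (iSup₂_le fun x hx => ?_) ?_
  · rw [← ofReal_norm]
    exact ENNReal.ofReal_le_ofReal (hf x hx)
  · refine HolderWith.eHolderNorm_le (C := c.toNNReal) fun x y => ?_
    have h := hH x x.2 y y.2
    rw [edist_dist, edist_dist, Subtype.dist_eq, dist_eq_norm, dist_eq_norm,
      ENNReal.ofReal_rpow_of_nonneg (norm_nonneg _) α.coe_nonneg]
    change _ ≤ ENNReal.ofReal c * _
    rw [← ENNReal.ofReal_mul hc]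
    exact ENNReal.ofReal_le_ofReal h

theorem holderNormOn_lt_top {α : ℝ≥0} (hα1 : α < 1) {S : Set Plane} (hS : Bornology.IsBounded S)
    {f : Plane → Plane} {L : ℝ≥0} {g : Plane → Plane} (hg : LipschitzWith L g) {a c : ℝ}
    (hc : 0 ≤ c) (hf : ∀ x, ‖f x - g x‖ ≤ a)
    (hH : ∀ x y, ‖(f x - g x) - (f y - g y)‖ ≤ c * ‖x - y‖ ^ (α : ℝ)) :
    holderNormOn α S f < ⊤ := by
  obtain ⟨D, hD⟩ := hS.exists_norm_le
  set d : ℝ := max D 0 with hd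
  have hd0 : 0 ≤ d := le_max_right _ _
  have hα1' : (0 : ℝ) < 1 - α := sub_pos.2 (by exact_mod_cast hα1)
  refine lt_of_le_of_lt (holderNormOn_le (a := a + (‖g 0‖ + L * d))
    (c := c + L * (d + d) ^ (1 - α : ℝ)) (by positivity) (fun x hx => ?_) fun x hx y hy => ?_)
    (ENNReal.add_lt_top.2 ⟨ENNReal.ofReal_lt_top, ENNReal.ofReal_lt_top⟩)
  · have h1 := hg.dist_le_mul x 0
    rw [dist_eq_norm, dist_zero_right] at h1
    have h2 : ‖x‖ ≤ d := (hD x hx).trans (le_max_left _ _)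
    have h3 : (L : ℝ) * ‖x‖ ≤ L * d := by gcongr
    have h4 := norm_sub_norm_le (g x) (g 0)
    have h5 := norm_sub_norm_le (f x) (g x)
    linarith [hf x]
  · have hxy : ‖x - y‖ ≤ d + d := (norm_sub_le x y).trans
      (add_le_add ((hD x hx).trans (le_max_left _ _)) ((hD y hy).trans (le_max_left _ _)))
    have h1 := hg.dist_le_mul x y
    rw [dist_eq_norm, dist_eq_norm] at h1
    have h2 : ‖x - y‖ ≤ (d + d) ^ (1 - α : ℝ) * ‖x - y‖ ^ (α : ℝ) := by
      rcases (norm_nonneg (x - y)).eq_or_lt with h0 | h0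
      · rw [← h0]
        positivity
      · calc ‖x - y‖ = ‖x - y‖ ^ (1 - α : ℝ) * ‖x - y‖ ^ (α : ℝ) := by
              rw [← Real.rpow_add h0, sub_add_cancel, Real.rpow_one]
          _ ≤ _ := by gcongr
    have h3 : (L : ℝ) * ‖x - y‖ ≤ L * ((d + d) ^ (1 - α : ℝ) * ‖x - y‖ ^ (α : ℝ)) := by gcongr
    have h4 : f x - f y = ((f x - g x) - (f y - g y)) + (g x - g y) := by abel
    rw [h4]
    refine (norm_add_le _ _).trans ?_
    linarith [hH x y]

theorem memLp_of_continuous {Ω : Set Plane} (hb : Bornology.IsBounded Ω) {u : Plane → Plane}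
    (hu : Continuous u) (q : ℝ≥0∞) : MemLp u q (volume.restrict Ω) := by
  obtain ⟨C, hC⟩ := (hb.isCompact_closure.image hu).isBounded.exists_norm_le
  have hfin : IsFiniteMeasure (volume.restrict Ω) := ⟨by simpa using hb.measure_lt_top⟩
  refine MemLp.of_bound hu.aestronglyMeasurable C ?_
  have : ∀ᵐ x ∂volume.restrict Ω, x ∈ closure Ω := by
    rw [ae_iff]
    change (volume.restrict Ω) (closure Ω)ᶜ = 0
    rw [Measure.restrict_apply isClosed_closure.measurableSet.compl]
    have : (closure Ω)ᶜ ∩ Ω = ∅ := (disjoint_compl_left_iff_subset.2 subset_closure).inter_eq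
    rw [this, measure_empty]
  filter_upwards [this] with x hx
  exact hC _ ⟨x, hx, rfl⟩

/-! ### Weights and classes of the staircase -/

/-- Choice of the weights of the staircase. -/
theorem exists_parameters {p : ℝ} (hp1 : 1 < p) (hp2 : p < 2) :
    ∃ s β₁ β₂ : ℝ, 0 < s ∧ s < 1 ∧ 0 < β₁ ∧ β₁ < 1 ∧ 0 < β₂ ∧ β₂ < 1 ∧
      1 + (1 - β₁) * s < β₁ * 2 ∧
      s ^ (p - 1) + (1 - β₂) * 2 ^ (p - 1) < β₂ * (s ^ (p - 1) * 2 ^ (p - 1)) ∧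
      β₁ * β₂ < 2⁻¹ ∧ ((2 : ℝ) ^ p)⁻¹ < β₁ * β₂ := by
  set R : ℝ := 2 ^ (p - 1) with hR
  have hR1 : 1 < R := Real.one_lt_rpow one_lt_two (by linarith)
  have hR2 : R < 2 := by
    calc R < 2 ^ (1 : ℝ) := Real.rpow_lt_rpow_of_exponent_lt one_lt_two (by linarith)
      _ = 2 := Real.rpow_one 2
  have hRp : (2 : ℝ) ^ p = 2 * R := by
    rw [hR, Real.rpow_sub_one two_ne_zero]
    ring
  -- With `s = c σ`, the inequality `l₁ l₂ < 1 / 2` below reduces to `σ (c (2 - R) + R) < 2 (R -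
  -- 1)`; as `c (2 - R) + R < 4`, the value `(R - 1) / 2` is enough.
  set σ : ℝ := (R - 1) / 2 with hσ
  have hσ0 : 0 < σ := by linarith
  have hσ1 : σ < 1 := by linarith
  -- The exponent makes `s ^ (2 - p) = σ`, hence `s = s ^ (p - 1) σ`. This is where `p < 2` is
  -- needed: `s` is smaller than `s ^ (p - 1)` by a prescribed factor.
  set s : ℝ := σ ^ (1 / (2 - p)) with hs
  have hs0 : 0 < s := by positivity
  have hs1 : s < 1 := Real.rpow_lt_one hσ0.le hσ1 (by apply one_div_pos.2; linarith)
  set c : ℝ := s ^ (p - 1) with hc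
  have hc0 : 0 < c := by positivity
  have hc1 : c < 1 := Real.rpow_lt_one hs0.le hs1 (by linarith)
  have hsc : s = c * σ := by
    have h1 : s ^ (2 - p) = σ := by
      rw [hs, ← Real.rpow_mul hσ0.le, one_div_mul_cancel (by linarith), Real.rpow_one]
    rw [← h1, hc, ← Real.rpow_add hs0]
    norm_num
  -- `l₁` and `l₂` are the infima of the weights allowed by the two barycentre conditions. They
  -- exceed `1 / 2` and `1 / R`, which gives the lower bound `2 ^ (-p)` for the product.
  set l₁ : ℝ := (1 + s) / (2 + s) with hl₁
  set l₂ : ℝ := (c + R) / (R * (1 + c)) with hl₂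
  have hl₁0 : 2⁻¹ < l₁ := by
    rw [hl₁, lt_div_iff₀ (by linarith)]
    linarith
  have hl₁1 : l₁ < 1 := by
    rw [hl₁, div_lt_one (by linarith)]
    linarith
  have hl₂0 : R⁻¹ < l₂ := by
    rw [hl₂, lt_div_iff₀ (by positivity), inv_mul_cancel_left₀ (by linarith)]
    linarith
  have hl₂1 : l₂ < 1 := by
    rw [hl₂, div_lt_one (by positivity)]
    nlinarith
  have hl₂pos : 0 < l₂ := lt_trans (by positivity) hl₂0
  have hll : l₁ * l₂ < 2⁻¹ := by
    rw [hl₁, hl₂, div_mul_div_comm, div_lt_iff₀ (by positivity), hsc]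
    have h1 : σ * (c * (2 - R) + R) < 2 * (R - 1) := by
      have : c * (2 - R) + R < 2 + 2 := by nlinarith
      nlinarith
    have h2 := mul_lt_mul_of_pos_left h1 hc0
    nlinarith
  obtain ⟨β₁, h1, h1'⟩ := exists_between (lt_min hl₁1 ((lt_div_iff₀ hl₂pos).2 hll))
  have hβ₁ : 0 < β₁ := by linarith
  have hll' : l₂ < 2⁻¹ / β₁ := by
    rw [lt_div_iff₀ hβ₁, mul_comm, ← lt_div_iff₀ hl₂pos]
    exact h1'.trans_le (min_le_right _ _)
  obtain ⟨β₂, h2, h2'⟩ := exists_between (lt_min hl₂1 hll')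
  have hβ₂ : 0 < β₂ := hl₂pos.trans h2
  refine ⟨s, β₁, β₂, hs0, hs1, hβ₁, h1'.trans_le (min_le_left _ _), hβ₂,
    h2'.trans_le (min_le_left _ _), ?_, ?_, ?_, ?_⟩
  · rw [hl₁, div_lt_iff₀ (by linarith)] at h1
    linarith
  · rw [hl₂, div_lt_iff₀ (by positivity)] at h2
    linarith
  · rw [mul_comm, ← lt_div_iff₀ hβ₁]
    exact h2'.trans_le (min_le_right _ _)
  · rw [hRp, mul_inv]
    exact mul_lt_mul'' (hl₁0.trans h1) (hl₂0.trans h2) (by norm_num) (by positivity)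

theorem norm_le_add_row (C : Mat) : ‖C‖ ≤ ‖row C 0‖ + ‖row C 1‖ := by
  rw [← sq_le_sq₀ (norm_nonneg _) (by positivity), norm_sq_eq_row]
  nlinarith [norm_nonneg (row C 0), norm_nonneg (row C 1)]

theorem rpow_sub_one_le {p x y : ℝ} (hp1 : 1 < p) (hp2 : p < 2) (hx : 0 ≤ x) (hxy : x ≤ y) (hy : 1 ≤ y) :
    x ^ (p - 1) ≤ y :=
  calc x ^ (p - 1) ≤ y ^ (p - 1) := Real.rpow_le_rpow hx hxy (by linarith)
    _ ≤ y ^ (1 : ℝ) := Real.rpow_le_rpow_of_exponent_le hy (by linarith)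
    _ = y := Real.rpow_one y

/-- The matrices with prescribed lengths of the rows. -/
def rowNorms (x y : ℝ) : Set Mat := {C | ‖row C 0‖ = x ∧ ‖row C 1‖ = y}

theorem norm_le_of_mem_rowNorms {x y z : ℝ} {C : Mat} (hC : C ∈ rowNorms x y) (hx : x ≤ z)
    (hy : y ≤ z) : ‖C‖ ≤ 2 * z := by
  have := norm_le_add_row C
  rw [hC.1, hC.2] at this
  linarith

theorem norm_le_of_mem_K {p : ℝ} (hp1 : 1 < p) (hp2 : p < 2) {C : Mat} (hC : C ∈ K p) {y : ℝ}
    (h : ‖row C 0‖ ≤ y) (hy : 1 ≤ y) : ‖C‖ ≤ 2 * y :=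
  norm_le_of_mem_rowNorms ⟨rfl, rfl⟩ h
    (norm_rows_of_mem_K hC ▸ rpow_sub_one_le hp1 hp2 (norm_nonneg _) h hy)

/-- Both vertices off `K p` have the first row enlarged. -/
theorem splits_first_row {p s β x : ℝ} (hs0 : 0 < s) (hs1 : s < 1) (hβ0 : 0 < β) (hβ1 : β < 1)
    (hβ : 1 + (1 - β) * s < β * 2) (hx : 0 < x) {L : ℝ≥0} (hL : 3 * x ≤ L) {C : Mat}
    (hC : C ∈ rowNorms x ((s * x) ^ (p - 1))) :
    Splits β L C {D | D ∈ K p ∧ ‖row D 0‖ = s * x} (rowNorms (2 * x) ((s * x) ^ (p - 1))) := by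
  obtain ⟨k, hk, hkK⟩ := exists_setRow_zero_mem_K (p := p) (mul_pos hs0 hx) hC.2
  have hsx : s * x < x := by nlinarith
  refine splits_of_row (i := 0) (k := k) (X := 2 * x) hβ0 hβ1 ?_ ?_ ⟨hkK, by rwa [row_setRow_self]⟩
    (fun z hz => ⟨by rwa [row_setRow_self], by rw [row_setRow_of_ne _ (by decide)]; exact hC.2⟩) ?_ ?_
  · rintro rfl
    exact hsx.ne (hk.symm.trans hC.1)
  · rw [hC.1, hk]
    nlinarith
  · rw [hC.1, hk]
    linarith
  · rw [hC.1]
    linarith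

/-- Both vertices off `K p` have the second row enlarged. -/
theorem splits_second_row {p s β x : ℝ} (hp1 : 1 < p) (hp2 : p < 2) (hs0 : 0 < s) (hs1 : s < 1)
    (hβ0 : 0 < β) (hβ1 : β < 1)
    (hβ : s ^ (p - 1) + (1 - β) * 2 ^ (p - 1) < β * (s ^ (p - 1) * 2 ^ (p - 1))) (hx : 1 ≤ x)
    {L : ℝ≥0} (hL : 4 * x ≤ L) {C : Mat} (hC : C ∈ rowNorms (2 * x) ((s * x) ^ (p - 1))) :
    Splits β L C {D | D ∈ K p ∧ ‖row D 0‖ = 2 * x}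
      (rowNorms (2 * x) ((s * (2 * x)) ^ (p - 1))) := by
  have hx0 : 0 < x := by linarith
  obtain ⟨k, hk, hkK⟩ := exists_setRow_one_mem_K (p := p) (mul_pos two_pos hx0) hC.1
  have hsx : s * x < x := by nlinarith
  have h1 : (s * x) ^ (p - 1) ≤ 2 * x :=
    rpow_sub_one_le hp1 hp2 (by positivity) (by linarith) (by linarith)
  have h2 : (2 * x) ^ (p - 1) ≤ 2 * x :=
    rpow_sub_one_le hp1 hp2 (by positivity) le_rfl (by linarith)
  have h3 : (s * (2 * x)) ^ (p - 1) ≤ 2 * x :=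
    rpow_sub_one_le hp1 hp2 (by positivity) (by nlinarith) (by linarith)
  refine splits_of_row (i := 1) (k := k) (X := (s * (2 * x)) ^ (p - 1)) hβ0 hβ1 ?_ ?_
    ⟨hkK, by rw [row_setRow_of_ne _ (by decide)]; exact hC.1⟩
    (fun z hz => ⟨by rw [row_setRow_of_ne _ (by decide)]; exact hC.1, by rwa [row_setRow_self]⟩) ?_ ?_
  · rintro rfl
    have : (s * x) ^ (p - 1) < (2 * x) ^ (p - 1) :=
      Real.rpow_lt_rpow (by positivity) (by linarith) (by linarith)
    exact this.ne (hC.2.symm.trans hk)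
  · rw [hC.2, hk, Real.mul_rpow hs0.le hx0.le,
      Real.mul_rpow hs0.le (by positivity), Real.mul_rpow two_pos.le hx0.le]
    have := mul_lt_mul_of_pos_right hβ (Real.rpow_pos_of_pos hx0 (p - 1))
    linarith
  · rw [hC.2, hk]
    linarith
  · rw [hC.2]
    linarith

/-- Every matrix with a short row splits into matrices in which this row has length `X`. -/
theorem splits_row_of_lt {y X β : ℝ} (hX : 0 < X) (hβ : y + (1 - β) * X < β * X) (hβ0 : 0 < β) (hβ1 : β < 1)
    {C : Mat} {i : Fin 2} (hC : ‖row C i‖ ≤ y) (hy : y < X) {L : ℝ≥0} (hL : 2 * X ≤ L) {S : Set Mat}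
    (hS : ∀ z, ‖z‖ = X → setRow C i z ∈ S) : Splits β L C S S := by
  -- Any vector of length `X` can serve as the first vertex, so that all three vertices have this
  -- length.
  have hk : ‖(EuclideanSpace.single 0 X : Plane)‖ = X := by
    rw [PiLp.norm_single, Real.norm_of_nonneg hX.le]
  refine splits_of_row (i := i) hβ0 hβ1 ?_ ?_ (hS _ hk) hS ?_ ?_
  · intro h
    rw [← h, hk] at hC
    linarith
  all_goals
    first | rw [hk] | skip
    linarith

/-- The active classes of the staircase. -/
def activeClass (p s ρ : ℝ) (A : Mat) : ℕ → Set Mat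
  | 0 => {A}
  | 1 => {C | ‖row C 0‖ = ρ ∧ row C 1 = row A 1}
  | n + 2 => rowNorms (ρ * 2 ^ ((n + 1) / 2)) ((s * (ρ * 2 ^ (n / 2))) ^ (p - 1))

/-- The length of the first row in the classes of gradients that are kept. -/
noncomputable def doneRadius (s ρ : ℝ) (n : ℕ) : ℝ :=
  if Even n then s * (ρ * 2 ^ (n / 2)) else 2 * (ρ * 2 ^ (n / 2))

/-- The classes of gradients that are kept. -/
def doneClass (p s ρ : ℝ) : ℕ → Set Mat
  | 0 => ∅
  | 1 => ∅
  | n + 2 => {C | C ∈ K p ∧ ‖row C 0‖ = doneRadius s ρ n}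

/-- The proportion of the active set that stays active. -/
noncomputable def activeWeight (β₁ β₂ : ℝ) : ℕ → ℝ
  | 0 => 1
  | 1 => 1
  | n + 2 => if Even n then β₁ else β₂

/-- The gradient bound on each level. -/
noncomputable def gradBound (ρ : ℝ) (n : ℕ) : ℝ≥0 := Real.toNNReal (8 * ρ * 2 ^ (n / 2))

theorem coe_gradBound {ρ : ℝ} (hρ : 0 ≤ ρ) (n : ℕ) : (gradBound ρ n : ℝ) = 8 * ρ * 2 ^ (n / 2) :=
  Real.coe_toNNReal _ (by positivity)

theorem stepRule_activeClass {p s β₁ β₂ ρ : ℝ} (hp1 : 1 < p) (hp2 : p < 2) (hs0 : 0 < s) (hs1 : s < 1)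
    (h10 : 0 < β₁) (h11 : β₁ < 1) (h20 : 0 < β₂) (h21 : β₂ < 1)
    (h1 : 1 + (1 - β₁) * s < β₁ * 2)
    (h2 : s ^ (p - 1) + (1 - β₂) * 2 ^ (p - 1) < β₂ * (s ^ (p - 1) * 2 ^ (p - 1)))
    (hρ : 1 ≤ ρ) {A : Mat} (hA0 : ‖row A 0‖ < ρ) (hA1 : ‖row A 1‖ < (s * ρ) ^ (p - 1)) (n : ℕ) :
    StepRule (activeWeight β₁ β₂ n) (gradBound ρ n) (activeClass p s ρ A n) (doneClass p s ρ n)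
      (activeClass p s ρ A (n + 1)) := by
  have hρ0 : 0 < ρ := by linarith
  -- The two preparatory steps leave everything active, so their `β` does not affect the areas and
  -- may be taken close to 1.
  have hb : ∀ {y X : ℝ}, 0 ≤ y → y < X → ∃ β, 0 < β ∧ β < 1 ∧ y + (1 - β) * X < β * X := by
    intro y X hy hyX
    have hX : 0 < X := by linarith
    obtain ⟨β, hβ, hβ1⟩ := exists_between (show (y + X) / (2 * X) < 1 by
      rw [div_lt_one (by positivity)]; linarith)
    refine ⟨β, lt_trans (by positivity) hβ, hβ1, ?_⟩
    rw [div_lt_iff₀ (by positivity)] at hβ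
    linarith
  match n with
  | 0 =>
    obtain ⟨β, hβ0, hβ1, hβ⟩ := hb (norm_nonneg _) hA0
    refine .inr ⟨rfl, β, ?_⟩
    rintro C rfl
    refine splits_row_of_lt (i := 0) hρ0 hβ hβ0 hβ1 le_rfl hA0 ?_ fun z hz =>
      ⟨by rwa [row_setRow_self], row_setRow_of_ne _ (by decide) _⟩
    rw [coe_gradBound hρ0.le]
    norm_num
    linarith
  | 1 =>
    obtain ⟨β, hβ0, hβ1, hβ⟩ := hb (norm_nonneg _) hA1
    refine .inr ⟨rfl, β, ?_⟩
    rintro C ⟨hC0, hC1⟩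
    refine splits_row_of_lt (i := 1) ((norm_nonneg _).trans_lt hA1) hβ hβ0 hβ1 (by rw [hC1]) hA1 ?_ fun z hz =>
      ⟨by rw [row_setRow_of_ne _ (by decide)]; simpa using hC0, by rw [row_setRow_self]; simpa using hz⟩
    rw [coe_gradBound hρ0.le]
    have : (s * ρ) ^ (p - 1) ≤ ρ := rpow_sub_one_le hp1 hp2 (by positivity) (by nlinarith) hρ
    norm_num
    linarith
  | n + 2 =>
    left
    intro C hC
    obtain ⟨m, rfl | rfl⟩ := Nat.even_or_odd' n
    · have e1 : (2 * m + 1) / 2 = m := by omega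
      have e2 : 2 * m / 2 = m := by omega
      have e3 : (2 * m + 1 + 1) / 2 = m + 1 := by omega
      have e4 : (2 * m + 2) / 2 = m + 1 := by omega
      have hE : Even (2 * m) := even_two_mul m
      have hx : 1 ≤ ρ * 2 ^ m := one_le_mul_of_one_le_of_one_le hρ (one_le_pow₀ one_le_two)
      -- With `x = ρ 2 ^ m`, an even step lengthens the first row and an odd step the second; the
      -- shift in the halved indices of `activeClass` records which row is ahead.
      simp only [activeClass, doneClass, activeWeight, doneRadius, e1, e2, e3, if_pos hE] at hC ⊢
      have := splits_first_row hs0 hs1 h10 h11 h1 (by linarith) (L := gradBound ρ (2 * m + 2)) (by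
        rw [coe_gradBound hρ0.le, e4, pow_succ]
        linarith) hC
      rwa [show 2 * (ρ * 2 ^ m) = ρ * 2 ^ (m + 1) by ring] at this
    · have e1 : (2 * m + 1) / 2 = m := by omega
      have e3 : (2 * m + 1 + 1) / 2 = m + 1 := by omega
      have e5 : (2 * m + 1 + 1 + 1) / 2 = m + 1 := by omega
      have e4 : (2 * m + 1 + 2) / 2 = m + 1 := by omega
      have hE : ¬ Even (2 * m + 1) := Nat.not_even_iff_odd.2 (odd_two_mul_add_one m)
      have hx : 1 ≤ ρ * 2 ^ m := one_le_mul_of_one_le_of_one_le hρ (one_le_pow₀ one_le_two)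
      have e6 : ρ * 2 ^ (m + 1) = 2 * (ρ * 2 ^ m) := by ring
      simp only [activeClass, doneClass, activeWeight, doneRadius, e1, e3, e5, if_neg hE, e6] at hC ⊢
      exact splits_second_row hp1 hp2 hs0 hs1 h20 h21 h2 hx (by
        rw [coe_gradBound hρ0.le, e4, pow_succ]
        linarith) hC

theorem doneRadius_le {s ρ : ℝ} (hs1 : s < 1) (hρ : 1 ≤ ρ) {n m : ℕ} (hnm : n < 2 * m) :
    doneRadius s ρ n ≤ ρ * 2 ^ m := by
  have hρ0 : 0 < ρ := by linarith
  unfold doneRadius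
  split_ifs with h
  · have h1 : ρ * 2 ^ (n / 2) ≤ ρ * 2 ^ m := by
      gcongr
      · norm_num
      · omega
    have h2 : 0 < ρ * 2 ^ (n / 2) := by positivity
    nlinarith
  · rw [mul_left_comm, ← pow_succ']
    gcongr
    · norm_num
    · have := Nat.not_even_iff_odd.1 h
      obtain ⟨k, rfl⟩ := this
      omega

theorem norm_le_of_mem_doneClass {p s ρ : ℝ} (hp1 : 1 < p) (hp2 : p < 2) (hs1 : s < 1) (hρ : 1 ≤ ρ)
    {m n : ℕ} (hn : n < 2 * m + 2) {C : Mat} (hC : C ∈ doneClass p s ρ n) : ‖C‖ ≤ 2 * (ρ * 2 ^ m) := by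
  match n with
  | 0 => exact hC.elim
  | 1 => exact hC.elim
  | n + 2 =>
    refine norm_le_of_mem_K hp1 hp2 hC.1 (hC.2.trans_le (doneRadius_le hs1 hρ (by omega))) ?_
    exact one_le_mul_of_one_le_of_one_le hρ (one_le_pow₀ one_le_two)

theorem norm_le_gradBound_of_mem_doneClass {p s ρ : ℝ} (hp1 : 1 < p) (hp2 : p < 2) (hs1 : s < 1)
    (hρ : 1 ≤ ρ) {n : ℕ} {C : Mat} (hC : C ∈ doneClass p s ρ n) : ‖C‖ ≤ gradBound ρ n := by
  have hρ0 : 0 < ρ := by linarith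
  have h := norm_le_of_mem_doneClass hp1 hp2 hs1 hρ (m := n / 2) (n := n) (by omega) hC
  rw [coe_gradBound hρ0.le]
  have : 0 < ρ * 2 ^ (n / 2) := by positivity
  linarith

theorem norm_le_gradBound_of_mem_activeClass {p s ρ : ℝ} (hp1 : 1 < p) (hp2 : p < 2) (hs0 : 0 < s)
    (hs1 : s < 1) (hρ : 1 ≤ ρ) {A : Mat} (hA0 : ‖row A 0‖ < ρ)
    (hA1 : ‖row A 1‖ < (s * ρ) ^ (p - 1)) {n : ℕ} {C : Mat} (hC : C ∈ activeClass p s ρ A n) :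
    ‖C‖ ≤ gradBound ρ n := by
  have hρ0 : 0 < ρ := by linarith
  have hsρ : (s * ρ) ^ (p - 1) ≤ ρ := rpow_sub_one_le hp1 hp2 (by positivity) (by nlinarith) hρ
  rw [coe_gradBound hρ0.le]
  match n with
  | 0 =>
    obtain rfl := hC
    have := norm_le_add_row C
    norm_num
    linarith
  | 1 =>
    have := norm_le_add_row C
    rw [hC.1, hC.2] at this
    norm_num
    linarith
  | n + 2 =>
    have hx : 1 ≤ ρ * 2 ^ (n / 2) := one_le_mul_of_one_le_of_one_le hρ (one_le_pow₀ one_le_two)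
    have e : (n + 2) / 2 = n / 2 + 1 := by omega
    have h1 : ρ * 2 ^ ((n + 1) / 2) ≤ 2 * (ρ * 2 ^ (n / 2)) := by
      rw [mul_left_comm, ← pow_succ']
      gcongr
      · norm_num
      · omega
    have h2 : (s * (ρ * 2 ^ (n / 2))) ^ (p - 1) ≤ 2 * (ρ * 2 ^ (n / 2)) :=
      rpow_sub_one_le hp1 hp2 (by positivity) (by nlinarith) (by linarith)
    have := norm_le_of_mem_rowNorms hC h1 h2
    rw [e, pow_succ]
    linarith

/-! ### Active areas and summability -/

theorem prod_activeWeight_even (β₁ β₂ : ℝ) (m : ℕ) :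
    ∏ i ∈ Finset.range (2 * m + 2), activeWeight β₁ β₂ i = (β₁ * β₂) ^ m := by
  induction m with
  | zero => simp [Finset.prod_range_succ, activeWeight]
  | succ m ih =>
    rw [show 2 * (m + 1) + 2 = 2 * m + 2 + 1 + 1 by ring, Finset.prod_range_succ, Finset.prod_range_succ, ih]
    have h1 : activeWeight β₁ β₂ (2 * m + 2) = β₁ := by simp [activeWeight]
    have h2 : activeWeight β₁ β₂ (2 * m + 2 + 1) = β₂ := by
      have : ¬ Even (2 * m + 1) := Nat.not_even_iff_odd.2 (odd_two_mul_add_one m)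
      change activeWeight β₁ β₂ (2 * m + 1 + 2) = β₂
      simp only [activeWeight, if_neg this]
    rw [h1, h2]
    ring

theorem prod_activeWeight_odd (β₁ β₂ : ℝ) (m : ℕ) :
    ∏ i ∈ Finset.range (2 * m + 3), activeWeight β₁ β₂ i = (β₁ * β₂) ^ m * β₁ := by
  rw [Finset.prod_range_succ, prod_activeWeight_even]
  simp [activeWeight]

theorem activeWeight_nonneg {β₁ β₂ : ℝ} (h1 : 0 < β₁) (h2 : 0 < β₂) (n : ℕ) :
    0 ≤ activeWeight β₁ β₂ n := by
  match n with
  | 0 => exact zero_le_one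
  | 1 => exact zero_le_one
  | n + 2 =>
    simp only [activeWeight]
    split_ifs
    exacts [h1.le, h2.le]

theorem prod_activeWeight_le {β₁ β₂ : ℝ} (h10 : 0 < β₁) (h11 : β₁ < 1) (h20 : 0 < β₂) (h21 : β₂ < 1)
    (n : ℕ) : ∏ i ∈ Finset.range n, activeWeight β₁ β₂ i ≤ (β₁ * β₂)⁻¹ * (β₁ * β₂) ^ (n / 2) := by
  have hβ : 0 < β₁ * β₂ := mul_pos h10 h20
  have hβ1 : β₁ * β₂ < 1 := mul_lt_one_of_nonneg_of_lt_one_left h10.le h11 h21.le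
  match n with
  | 0 => simpa using (one_le_inv₀ hβ).2 hβ1.le
  | 1 => simpa [activeWeight] using (one_le_inv₀ hβ).2 hβ1.le
  | n + 2 =>
    have e : (n + 2) / 2 = n / 2 + 1 := by omega
    rw [e, pow_succ', inv_mul_cancel_left₀ hβ.ne']
    obtain ⟨m, rfl | rfl⟩ := Nat.even_or_odd' n
    · rw [prod_activeWeight_even, show 2 * m / 2 = m by omega]
    · rw [show 2 * m + 1 + 2 = 2 * m + 3 by ring, prod_activeWeight_odd, show (2 * m + 1) / 2 = m by omega]
      exact mul_le_of_le_one_right (by positivity) h11.le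

theorem tendsto_prod_activeWeight {β₁ β₂ : ℝ} (h10 : 0 < β₁) (h11 : β₁ < 1) (h20 : 0 < β₂) (h21 : β₂ < 1) :
    Tendsto (fun n => ∏ i ∈ Finset.range n, activeWeight β₁ β₂ i) atTop (𝓝 0) := by
  have hβ : 0 < β₁ * β₂ := mul_pos h10 h20
  have hβ1 : β₁ * β₂ < 1 := mul_lt_one_of_nonneg_of_lt_one_left h10.le h11 h21.le
  refine squeeze_zero (fun n => Finset.prod_nonneg fun i _ => activeWeight_nonneg h10 h20 i)
    (prod_activeWeight_le h10 h11 h20 h21) ?_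
  have := ((tendsto_pow_atTop_nhds_zero_of_lt_one hβ.le hβ1).comp
    (Nat.tendsto_div_const_atTop two_ne_zero)).const_mul (β₁ * β₂)⁻¹
  simpa using this

/-- The gradient bound doubles and the active area shrinks by `β₁ β₂` every two levels. The series
is thus dominated by a geometric series of ratio `2 ^ q β₁ β₂`, each term taken twice. -/
theorem tsum_gradBound_rpow_ne_top {β₁ β₂ ρ q : ℝ} (h10 : 0 < β₁) (h11 : β₁ < 1) (h20 : 0 < β₂)
    (h21 : β₂ < 1) (hρ : 0 < ρ) (hq : 0 ≤ q) (hβ : 2 ^ q * (β₁ * β₂) < 1) {V : ℝ≥0∞} (hV : V ≠ ⊤) :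
    ∑' n, (gradBound ρ n : ℝ≥0∞) ^ q *
      (ENNReal.ofReal (∏ i ∈ Finset.range n, activeWeight β₁ β₂ i) * V) ≠ ⊤ := by
  have hβ0 : 0 < β₁ * β₂ := mul_pos h10 h20
  set c : ℝ := (8 * ρ) ^ q * (β₁ * β₂)⁻¹ with hc
  set r : ℝ := 2 ^ q * (β₁ * β₂) with hr
  have hr0 : 0 < r := by positivity
  have hle : ∀ n, (gradBound ρ n : ℝ≥0∞) ^ q *
      (ENNReal.ofReal (∏ i ∈ Finset.range n, activeWeight β₁ β₂ i) * V) ≤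
        ENNReal.ofReal c * V * ENNReal.ofReal r ^ (n / 2) := by
    intro n
    have h1 : (gradBound ρ n : ℝ≥0∞) ^ q = ENNReal.ofReal ((8 * ρ) ^ q * (2 ^ q) ^ (n / 2)) := by
      have : (gradBound ρ n : ℝ≥0∞) = ENNReal.ofReal (8 * ρ * 2 ^ (n / 2)) := rfl
      rw [this, ENNReal.ofReal_rpow_of_nonneg (by positivity) hq,
        Real.mul_rpow (by positivity) (by positivity), ← Real.rpow_natCast, ← Real.rpow_natCast,
        ← Real.rpow_mul two_pos.le, ← Real.rpow_mul two_pos.le, mul_comm q]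
    rw [h1, ← mul_assoc, ← ENNReal.ofReal_mul (by positivity), mul_right_comm (ENNReal.ofReal c),
      ← ENNReal.ofReal_pow hr0.le, ← ENNReal.ofReal_mul (by positivity)]
    gcongr ENNReal.ofReal ?_ * _
    calc (8 * ρ) ^ q * (2 ^ q) ^ (n / 2) * ∏ i ∈ Finset.range n, activeWeight β₁ β₂ i
        ≤ (8 * ρ) ^ q * (2 ^ q) ^ (n / 2) * ((β₁ * β₂)⁻¹ * (β₁ * β₂) ^ (n / 2)) := by
          gcongr
          exact prod_activeWeight_le h10 h11 h20 h21 n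
      _ = c * r ^ (n / 2) := by
          rw [hc, hr, mul_pow]
          ring
  refine ne_top_of_le_ne_top ?_ (ENNReal.tsum_le_tsum hle)
  rw [ENNReal.tsum_mul_left, ← tsum_even_add_odd ENNReal.summable ENNReal.summable]
  have e1 : ∀ k, 2 * k / 2 = k := fun k => by omega
  have e2 : ∀ k, (2 * k + 1) / 2 = k := fun k => by omega
  simp only [e1, e2, ENNReal.tsum_geometric]
  have hr' : (1 - ENNReal.ofReal r)⁻¹ ≠ ⊤ := by
    rw [ENNReal.inv_ne_top]
    exact (tsub_pos_of_lt (by simpa using hβ)).ne'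
  exact ENNReal.mul_ne_top (ENNReal.mul_ne_top ENNReal.ofReal_ne_top hV) (ENNReal.add_ne_top.2 ⟨hr', hr'⟩)

theorem doneRadius_odd (s ρ : ℝ) (m : ℕ) : doneRadius s ρ (2 * m + 1) = ρ * 2 ^ (m + 1) := by
  have : ¬ Even (2 * m + 1) := Nat.not_even_iff_odd.2 (odd_two_mul_add_one m)
  rw [doneRadius, if_neg this, show (2 * m + 1) / 2 = m by omega]
  ring

theorem activeWeight_odd (β₁ β₂ : ℝ) (m : ℕ) : activeWeight β₁ β₂ (2 * m + 3) = β₂ := by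
  have : ¬ Even (2 * m + 1) := Nat.not_even_iff_odd.2 (odd_two_mul_add_one m)
  change activeWeight β₁ β₂ (2 * m + 1 + 2) = β₂
  simp only [activeWeight, if_neg this]

theorem doneClass_subset_K {p s ρ : ℝ} {n : ℕ} : doneClass p s ρ n ⊆ K p := by
  intro C hC
  match n with
  | 0 => exact hC.elim
  | 1 => exact hC.elim
  | n + 2 => exact hC.1

/-! ### The power tail of the gradient -/

section Tail

variable {p s β₁ β₂ ρ : ℝ} {Ω : Set Plane} {A : Mat} {b : Plane} {L : ℕ → ℝ≥0} {η : ℕ → ℝ}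
  {u : ℕ → Plane → Plane} {P Q : ℕ → Set (Set Plane)}

theorem volume_done_odd (h10 : 0 < β₁) (h20 : 0 < β₂)
    (h : IsStaircase Ω A b (activeWeight β₁ β₂) L (activeClass p s ρ A) (doneClass p s ρ) η u P Q)
    (hΩ : volume Ω ≠ ⊤) (m : ℕ) :
    volume (⋃₀ Q (2 * m + 3)) =
      ENNReal.ofReal ((1 - β₂) * ((β₁ * β₂) ^ m * β₁)) * volume Ω := by
  rw [h.volume_done (activeWeight_nonneg h10 h20) _ hΩ, prod_activeWeight_odd, activeWeight_odd]

/-- Gradients finished before level `2 m + 2` are at most `2 ρ 2 ^ m`, so larger ones occur only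
where the construction was still active at that level. -/
theorem volume_real_tail_le (hp1 : 1 < p) (hp2 : p < 2) (hs1 : s < 1) (hρ : 1 ≤ ρ)
    (h10 : 0 < β₁) (h20 : 0 < β₂)
    (h : IsStaircase Ω A b (activeWeight β₁ β₂) L (activeClass p s ρ A) (doneClass p s ρ) η u P Q)
    (hη : Summable η) (hΩ : volume Ω ≠ ⊤) (hnull : volume (Ω \ ⋃ n, ⋃₀ Q n) = 0) {m : ℕ} {t : ℝ}
    (ht : 2 * (ρ * 2 ^ m) ≤ t) :
    volume.real {x | x ∈ Ω ∧ t < ‖jacobian (limitMap u) x‖} ≤ (β₁ * β₂) ^ m * volume.real Ω := by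
  have hsub : {x | x ∈ Ω ∧ t < ‖jacobian (limitMap u) x‖} ⊆
      (Ω \ ⋃ n, ⋃₀ Q n) ∪ ⋃₀ P (2 * m + 2) := by
    rintro x ⟨hx, hxt⟩
    by_cases hxQ : x ∈ ⋃ n, ⋃₀ Q n
    · right
      obtain ⟨n, hn⟩ := mem_iUnion.1 hxQ
      rcases lt_or_ge n (2 * m + 2) with hnm | hnm
      · exact absurd (norm_le_of_mem_doneClass hp1 hp2 hs1 hρ hnm (h.jacobian_limitMap_mem hη hn))
          (by linarith)
      · exact h.antitone hnm ((h.step n).done_subset hn)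
    · exact .inl ⟨hx, hxQ⟩
  have hv := (measure_mono (μ := volume) hsub).trans (measure_union_le _ _)
  rw [hnull, zero_add, h.volume_active (activeWeight_nonneg h10 h20), prod_activeWeight_even] at hv
  have := ENNReal.toReal_mono (ENNReal.mul_ne_top ENNReal.ofReal_ne_top hΩ) hv
  rwa [ENNReal.toReal_mul, ENNReal.toReal_ofReal (by positivity)] at this

/-- The pieces finished at level `2 m + 3`, a second-row step, already have a first row of length `ρ
2 ^ (m + 1)`. -/
theorem le_volume_real_tail (h10 : 0 < β₁) (h20 : 0 < β₂) (h21 : β₂ < 1)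
    (h : IsStaircase Ω A b (activeWeight β₁ β₂) L (activeClass p s ρ A) (doneClass p s ρ) η u P Q)
    (hη : Summable η) (hΩ : volume Ω ≠ ⊤) {m : ℕ} {t : ℝ} (ht : t < ρ * 2 ^ (m + 1)) :
    (1 - β₂) * β₁ * (β₁ * β₂) ^ m * volume.real Ω ≤
      volume.real {x | x ∈ Ω ∧ t < ‖jacobian (limitMap u) x‖} := by
  have hsub : ⋃₀ Q (2 * m + 3) ⊆ {x | x ∈ Ω ∧ t < ‖jacobian (limitMap u) x‖} := by
    intro x hx
    refine ⟨h.done_subset _ hx, ht.trans_le ?_⟩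
    have := (h.jacobian_limitMap_mem hη hx).2
    rw [doneRadius_odd] at this
    rw [← this]
    exact norm_row_le _ _
  have hv := ENNReal.toReal_mono (measure_ne_top_of_subset (fun x hx => hx.1) hΩ) (measure_mono (μ := volume) hsub)
  rw [volume_done_odd h10 h20 h hΩ, ENNReal.toReal_mul, ENNReal.toReal_ofReal (by
    have : 0 ≤ 1 - β₂ := by linarith
    positivity)] at hv
  refine le_trans (le_of_eq ?_) hv
  rw [Measure.real]
  ring

/-- Under `2 ^ q β₁ β₂ = 1`, the pieces finished at the levels `2 m + 3` all contribute the same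
positive amount to the integral. -/
theorem lintegral_row_eq_top {q : ℝ} (h10 : 0 < β₁) (h20 : 0 < β₂) (h21 : β₂ < 1)
    (hq : 0 ≤ q) (hβ : 2 ^ q * (β₁ * β₂) = 1) (hρ : 0 < ρ)
    (h : IsStaircase Ω A b (activeWeight β₁ β₂) L (activeClass p s ρ A) (doneClass p s ρ) η u P Q)
    (hη : Summable η) (hΩ : volume Ω ≠ ⊤) (hΩ0 : volume Ω ≠ 0) :
    ∫⁻ x in Ω, ‖row (jacobian (limitMap u) x) 0‖ₑ ^ q = ⊤ := by
  have hsub : ⋃ m, ⋃₀ Q (2 * m + 3) ⊆ Ω := iUnion_subset fun m => h.done_subset _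
  refine top_unique (le_trans ?_ (lintegral_mono_set hsub))
  have hm : ∀ m, MeasurableSet (⋃₀ Q (2 * m + 3)) := fun m => (h.step _).done.isOpen_sUnion.measurableSet
  rw [lintegral_iUnion hm (fun i j hij => h.disjoint_done (by omega))]
  have hval : ∀ m, ∫⁻ x in ⋃₀ Q (2 * m + 3), ‖row (jacobian (limitMap u) x) 0‖ₑ ^ q =
      ENNReal.ofReal ((ρ * 2) ^ q * ((1 - β₂) * β₁)) * volume Ω := by
    intro m
    have hc : ∫⁻ x in ⋃₀ Q (2 * m + 3), ‖row (jacobian (limitMap u) x) 0‖ₑ ^ q =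
        ∫⁻ _ in ⋃₀ Q (2 * m + 3), ENNReal.ofReal (ρ * 2 ^ (m + 1)) ^ q := by
      refine setLIntegral_congr_fun (hm m) fun x hx => ?_
      have := (h.jacobian_limitMap_mem hη hx).2
      rw [doneRadius_odd] at this
      rw [← ofReal_norm, this]
    rw [hc, setLIntegral_const, volume_done_odd h10 h20 h hΩ, ← mul_assoc,
      ENNReal.ofReal_rpow_of_nonneg (by positivity) hq, ← ENNReal.ofReal_mul (by positivity)]
    congr 2
    have h2 : ((2 : ℝ) ^ m) ^ q = (2 ^ q) ^ m := by
      rw [← Real.rpow_natCast, ← Real.rpow_natCast, ← Real.rpow_mul two_pos.le,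
        ← Real.rpow_mul two_pos.le, mul_comm]
    have h1 : (ρ * 2 ^ (m + 1)) ^ q = (ρ * 2) ^ q * (2 ^ q) ^ m := by
      rw [pow_succ', ← mul_assoc, Real.mul_rpow (by positivity) (by positivity), h2]
    calc (ρ * 2 ^ (m + 1)) ^ q * ((1 - β₂) * ((β₁ * β₂) ^ m * β₁))
        = (ρ * 2) ^ q * ((1 - β₂) * β₁) * (2 ^ q * (β₁ * β₂)) ^ m := by
          rw [h1, mul_pow]
          ring
      _ = _ := by rw [hβ, one_pow, mul_one]
  simp only [hval]
  refine (ENNReal.tsum_const_eq_top_of_ne_zero (mul_ne_zero ?_ hΩ0)).ge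
  rw [ENNReal.ofReal_ne_zero_iff]
  have : 0 < 1 - β₂ := by linarith
  positivity

end Tail

theorem one_add_rpow_le {a e : ℝ} (ha : 0 ≤ a) (he : 0 ≤ e) : (1 + a) ^ e ≤ 2 ^ e * (1 + a ^ e) := by
  have h0 : 0 ≤ a ^ e := Real.rpow_nonneg ha e
  rcases le_total a 1 with h | h
  · calc (1 + a) ^ e ≤ 2 ^ e := by gcongr; linarith
      _ ≤ 2 ^ e * (1 + a ^ e) := le_mul_of_one_le_right (by positivity) (by linarith)
  · calc (1 + a) ^ e ≤ (2 * a) ^ e := by gcongr; linarith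
      _ = 2 ^ e * a ^ e := Real.mul_rpow two_pos.le ha
      _ ≤ 2 ^ e * (1 + a ^ e) := by gcongr; linarith

theorem one_add_rpow_mul_le {a r q : ℝ} (ha : 0 ≤ a) (hr0 : 0 ≤ r) (hr : r ≤ 1) (hq : 0 ≤ q) :
    1 + a ^ (r * q) ≤ 2 * (1 + a) ^ q := by
  have h1 : 1 ≤ (1 + a) ^ q := Real.one_le_rpow (by linarith) hq
  have h2 : a ^ (r * q) ≤ (1 + a) ^ q :=
    calc a ^ (r * q) ≤ (1 + a) ^ (r * q) := by gcongr; linarith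
      _ ≤ (1 + a) ^ q := Real.rpow_le_rpow_of_exponent_le (by linarith) (by nlinarith)
  linarith

/-- Geometric decay along the scales `ρ 2 ^ m` amounts to a power tail. -/
theorem tail_bounds {p s q ρ a c β : ℝ} (hp1 : 1 < p) (hp2 : p < 2) (hs0 : 0 < s) (hs1 : s < 1)
    (hq : 0 < q) (ha : 0 ≤ a) (hc : 0 < c) (hβ : β = 2 ^ (-q))
    (hρ : ρ = (1 + a) ^ (1 / (p - 1)) / s) (F : ℝ → ℝ) (hF1 : ∀ t, F t ≤ 1)
    (hF : ∀ (m : ℕ) (t : ℝ), 2 * (ρ * 2 ^ m) ≤ t → F t ≤ β ^ m)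
    (hF' : ∀ (m : ℕ) (t : ℝ), t < ρ * 2 ^ (m + 1) → c * β ^ m ≤ F t) {t : ℝ} (ht : 1 + a < t) :
    (1 + (4 / s) ^ q * 2 ^ (q / (p - 1)) + 2 / (c * β))⁻¹ * (1 + a ^ ((p - 1) * q)) * t ^ (-q) ≤ F t ∧
      F t ≤ (1 + (4 / s) ^ q * 2 ^ (q / (p - 1)) + 2 / (c * β)) * (1 + a ^ (q / (p - 1))) * t ^ (-q) := by
  have hp : 0 < p - 1 := by linarith
  have hβ0 : 0 < β := hβ ▸ by positivity
  have hβ1 : β < 1 := hβ ▸ Real.rpow_lt_one_of_one_lt_of_neg one_lt_two (by linarith)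
  have ht0 : 0 < t := by linarith
  have hρ0 : 0 < ρ := by rw [hρ]; positivity
  have hρa : 1 + a ≤ ρ := by
    rw [hρ, le_div_iff₀ hs0]
    have h1 : 1 + a ≤ (1 + a) ^ (1 / (p - 1)) := by
      calc 1 + a = (1 + a) ^ (1 : ℝ) := (Real.rpow_one _).symm
        _ ≤ (1 + a) ^ (1 / (p - 1)) := by
          refine Real.rpow_le_rpow_of_exponent_le (by linarith) ?_
          rw [le_div_iff₀ hp]
          linarith
    nlinarith
  have hpow : ∀ m : ℕ, β ^ m = ((2 : ℝ) ^ m) ^ (-q) := fun m => by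
    rw [hβ, ← Real.rpow_natCast, ← Real.rpow_natCast, ← Real.rpow_mul two_pos.le,
      ← Real.rpow_mul two_pos.le, mul_comm]
  have hdiv : ∀ {y : ℝ}, 0 < y → (t / y) ^ (-q) = y ^ q * t ^ (-q) := fun {y} hy => by
    rw [Real.div_rpow ht0.le hy.le, Real.rpow_neg hy.le, div_inv_eq_mul, mul_comm]
  have htq : 0 < t ^ (-q) := by positivity
  have hone : ∀ {y : ℝ}, 0 < y → t ≤ y → 1 ≤ y ^ q * t ^ (-q) := fun {y} hy hty => by
    rw [← hdiv hy]
    exact Real.one_le_rpow_of_pos_of_le_one_of_nonpos (by positivity) ((div_le_one hy).2 hty) (by linarith)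
  have hone' : (1 + a) ^ q * t ^ (-q) ≤ 1 := by
    rw [← hdiv (by linarith)]
    exact Real.rpow_le_one_of_one_le_of_nonpos ((one_le_div (by linarith)).2 ht.le) (by linarith)
  -- Below `2 ρ` the scale `m = 0` suffices, since `t > 1 + a`. Above it, `t` lies between
  -- consecutive dyadic multiples of `2 ρ`, and the bound is used one scale higher, which costs the
  -- factor `β`.
  have hlow : c * β * ((1 + a) ^ q * t ^ (-q)) ≤ F t := by
    rcases lt_or_ge t (2 * ρ) with h | h
    · have h1 := hF' 0 t (by rw [zero_add, pow_one]; linarith)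
      rw [pow_zero, mul_one] at h1
      have h2 : c * β ≤ c := by nlinarith
      have h3 : c * β * ((1 + a) ^ q * t ^ (-q)) ≤ c * β := mul_le_of_le_one_right (by positivity) hone'
      linarith
    · obtain ⟨m, hm, hm'⟩ := exists_nat_pow_near ((one_le_div (by positivity)).2 h) one_lt_two
      rw [le_div_iff₀ (by positivity)] at hm
      rw [div_lt_iff₀ (by positivity)] at hm'
      have h1 := hF' (m + 1) t (by rw [pow_succ (2 : ℝ) (m + 1)]; linarith)
      refine le_trans ?_ h1
      rw [pow_succ', mul_assoc c β, hpow]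
      gcongr c * (β * ?_)
      calc (1 + a) ^ q * t ^ (-q) ≤ (2 * ρ) ^ q * t ^ (-q) := by gcongr; linarith
        _ = (t / (2 * ρ)) ^ (-q) := (hdiv (by positivity)).symm
        _ ≤ (2 ^ m) ^ (-q) := by
          refine Real.rpow_le_rpow_of_nonpos (by positivity) ?_ (by linarith)
          rwa [le_div_iff₀ (by positivity)]
  -- Below `2 ρ` the trivial bound 1 is enough. Above, `t < 4 ρ 2 ^ m` turns `β ^ m = (2 ^ m) ^
  -- (-q)` into a power of `t / (4 ρ)`.
  have hup : F t ≤ (4 * ρ) ^ q * t ^ (-q) := by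
    rcases lt_or_ge t (2 * ρ) with h | h
    · exact (hF1 t).trans (hone (by positivity) (by linarith))
    · obtain ⟨m, hm, hm'⟩ := exists_nat_pow_near ((one_le_div (by positivity)).2 h) one_lt_two
      rw [le_div_iff₀ (by positivity)] at hm
      rw [div_lt_iff₀ (by positivity), pow_succ] at hm'
      refine (hF m t (by linarith)).trans ?_
      rw [hpow, ← hdiv (by positivity)]
      refine Real.rpow_le_rpow_of_nonpos (by positivity) ?_ (by linarith)
      rw [div_le_iff₀ (by positivity)]
      linarith
  have hX : 0 < (4 / s) ^ q * 2 ^ (q / (p - 1)) := by positivity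
  have hY : 0 < 2 / (c * β) := by positivity
  constructor
  · refine le_trans ?_ hlow
    rw [← mul_assoc (c * β)]
    gcongr ?_ * _
    rw [inv_mul_le_iff₀ (by positivity)]
    have h1 := one_add_rpow_mul_le ha hp.le (by linarith) hq.le (r := p - 1)
    have h2 : 2 * (1 + a) ^ q = 2 / (c * β) * (c * β * (1 + a) ^ q) := by field_simp
    have h3 : 0 < c * β * (1 + a) ^ q := by positivity
    nlinarith
  · refine hup.trans ?_
    gcongr ?_ * _
    have h1 : (4 * ρ) ^ q = (4 / s) ^ q * (1 + a) ^ (q / (p - 1)) := by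
      rw [hρ, show 4 * ((1 + a) ^ (1 / (p - 1)) / s) = 4 / s * (1 + a) ^ (1 / (p - 1)) by ring,
        Real.mul_rpow (by positivity) (by positivity), ← Real.rpow_mul (by linarith),
        one_div_mul_eq_div]
    rw [h1]
    have h2 := one_add_rpow_le ha (show 0 ≤ q / (p - 1) by positivity)
    have h3 : 0 < 1 + a ^ (q / (p - 1)) := by positivity
    have h4 : (4 / s) ^ q * (1 + a) ^ (q / (p - 1)) ≤
        (4 / s) ^ q * (2 ^ (q / (p - 1)) * (1 + a ^ (q / (p - 1)))) := by gcongr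
    nlinarith

/-! ### Assembly of the solution -/

theorem exists_isStaircase_holder {Ω : Set Plane} (hΩ : IsRegularDomain Ω) {A : Mat} (b : Plane)
    {κ : ℕ → ℝ} {L : ℕ → ℝ≥0} {S T : ℕ → Set Mat} (hA : A ∈ S 0)
    (h : ∀ n, StepRule (κ n) (L n) (S n) (T n) (S (n + 1))) {α : ℝ≥0} (hα1 : α < 1) {δ : ℝ}
    (hδ : 0 < δ) :
    ∃ (u : ℕ → Plane → Plane) (P Q : ℕ → Set (Set Plane)) (η : ℕ → ℝ),
      IsStaircase Ω A b κ L S T η u P Q ∧ Summable η ∧ (∀ n, 0 ≤ η n) ∧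
      (∀ x, ‖limitMap u x - affineMap A b x‖ ≤ δ) ∧
      ∀ x y, ‖(limitMap u x - affineMap A b x) - (limitMap u y - affineMap A b y)‖ ≤
        δ * ‖x - y‖ ^ (α : ℝ) := by
  have hθ : HasSum (fun n : ℕ => δ / 2 / 2 ^ n) δ := by
    simpa using hasSum_geometric_two' δ
  have hθ0 : ∀ n : ℕ, 0 < δ / 2 / 2 ^ n := fun n => by positivity
  choose ε hε0 hεle hεH using fun n => exists_holder_of_lipschitz (4 * L n) hα1 (hθ0 n)
  obtain ⟨u, P, Q, hu⟩ := exists_isStaircase hΩ b hA h hε0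
  have hsum : Summable ε := Summable.of_nonneg_of_le (fun n => (hε0 n).le) hεle hθ.summable
  refine ⟨u, P, Q, ε, hu, hsum, fun n => (hε0 n).le, fun x => ?_, fun x y => ?_⟩
  · exact (hu.norm_limitMap_sub_le hsum x).trans ((hsum.tsum_le_tsum hεle hθ.summable).trans hθ.tsum_eq.le)
  · have := hu.holder_limitMap hsum (α := (α : ℝ)) hθ.summable
      (fun n x y => hεH n _ (hu.step n).lipschitz (hu.step n).small x y) x y
    rwa [hθ.tsum_eq] at this

end PLaplace

open PLaplace in
theorem mainTheorem12 (p : ℝ) (hp1 : 1 < p) (hp2 : p < 2) :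
    ∃ qbar M : ℝ, 1 < qbar ∧ qbar < p ∧ 1 < M ∧
      ∀ (A : PLaplace.Mat) (b : PLaplace.Plane) (α : ℝ≥0) (δ : ℝ) (Ω : Set PLaplace.Plane),
        0 < α → α < 1 → 0 < δ → δ < 1 → PLaplace.IsRegularDomain Ω →
        ∃ (u : PLaplace.Plane → PLaplace.Plane) (G : PLaplace.Plane → PLaplace.Mat),
          PLaplace.IsPiecewiseAffine Ω u ∧
          PLaplace.MemW1 1 Ω u ∧
          PLaplace.IsWeakGradient Ω u G ∧
          PLaplace.holderNormOn α (closure Ω) u < ⊤ ∧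
          (∀ x ∈ frontier Ω, u x = PLaplace.affineMap A b x) ∧
          PLaplace.holderNormOn α (closure Ω) (fun x => u x - PLaplace.affineMap A b x)
            < ENNReal.ofReal δ ∧
          (∀ᵐ x ∂(volume.restrict Ω), G x ∈ PLaplace.K p) ∧
          (∀ t : ℝ, 1 + ‖A‖ < t →
            M⁻¹ * (1 + ‖A‖ ^ ((p - 1) * qbar)) * t ^ (-qbar)
                ≤ volume.real {x | x ∈ Ω ∧ t < ‖G x‖} / volume.real Ω ∧
              volume.real {x | x ∈ Ω ∧ t < ‖G x‖} / volume.real Ω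
                ≤ M * (1 + ‖A‖ ^ (qbar / (p - 1))) * t ^ (-qbar)) ∧
          (∀ q : ℝ, 1 ≤ q → q < qbar → PLaplace.MemW1 (ENNReal.ofReal q) Ω u) ∧
          ∫⁻ x in Ω, ‖G x‖ₑ ^ qbar = ⊤ ∧
          PLaplace.IsVeryWeakPLaplaceSolution p Ω (fun x => u x 0) ∧
          ∫⁻ x in Ω, ‖(WithLp.toLp 2 (G x 0) : PLaplace.Plane)‖ₑ ^ qbar = ⊤ := by
  obtain ⟨s, β₁, β₂, hs0, hs1, h10, h11, h20, h21, h1, h2, hβlt, hβgt⟩ := exists_parameters hp1 hp2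
  have hβ0 : 0 < β₁ * β₂ := mul_pos h10 h20
  -- The exponent for which doubling the gradient exactly balances the loss of area in one cycle.
  set q : ℝ := -Real.logb 2 (β₁ * β₂) with hq
  have hβq : β₁ * β₂ = 2 ^ (-q) := by
    rw [hq, neg_neg, Real.rpow_logb two_pos (by norm_num) hβ0]
  have hq1 : 1 < q := by
    have h : (2 : ℝ) ^ (-q) < 2 ^ (-1 : ℝ) := by rwa [← hβq, Real.rpow_neg_one]
    linarith [(Real.rpow_lt_rpow_left_iff one_lt_two).1 h]
  have hqp : q < p := by
    have h : (2 : ℝ) ^ (-p) < 2 ^ (-q) := by rwa [← hβq, Real.rpow_neg two_pos.le]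
    linarith [(Real.rpow_lt_rpow_left_iff one_lt_two).1 h]
  have hc : 0 < (1 - β₂) * β₁ := mul_pos (by linarith) h10
  refine ⟨q, 1 + (4 / s) ^ q * 2 ^ (q / (p - 1)) + 2 / ((1 - β₂) * β₁ * (β₁ * β₂)), hq1, hqp, ?_, ?_⟩
  · have hX : 0 < (4 / s) ^ q * 2 ^ (q / (p - 1)) := by positivity
    have hY : 0 < 2 / ((1 - β₂) * β₁ * (β₁ * β₂)) := by positivity
    linarith
  intro A b α δ Ω _ hα1 hδ _ hΩ
  have hp : 0 < p - 1 := by linarith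
  -- Chosen so that `(s ρ) ^ (p - 1) = 1 + ‖A‖`: both rows of `A` are then shorter than their
  -- initial targets `ρ` and `(s ρ) ^ (p - 1)`. The power `1 / (p - 1)` is the source of the
  -- exponent `q / (p - 1)` in the upper tail bound.
  set ρ : ℝ := (1 + ‖A‖) ^ (1 / (p - 1)) / s with hρ
  have hρA : 1 + ‖A‖ ≤ ρ := by
    rw [hρ, le_div_iff₀ hs0]
    have h : 1 + ‖A‖ ≤ (1 + ‖A‖) ^ (1 / (p - 1)) :=
      calc 1 + ‖A‖ = (1 + ‖A‖) ^ (1 : ℝ) := (Real.rpow_one _).symm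
        _ ≤ (1 + ‖A‖) ^ (1 / (p - 1)) := by
          refine Real.rpow_le_rpow_of_exponent_le (by linarith [norm_nonneg A]) ?_
          rw [le_div_iff₀ hp]
          linarith
    nlinarith [norm_nonneg A]
  have hρ1 : 1 ≤ ρ := by linarith [norm_nonneg A]
  have hA0 : ‖row A 0‖ < ρ := by linarith [norm_row_le A 0]
  have hA1 : ‖row A 1‖ < (s * ρ) ^ (p - 1) := by
    rw [hρ, mul_div_cancel₀ _ hs0.ne', ← Real.rpow_mul (by positivity), one_div_mul_cancel hp.ne',
      Real.rpow_one]
    linarith [norm_row_le A 1]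
  -- The sup norm and the Hölder seminorm are each at most `δ / 4`, so their sum is strictly below
  -- `δ`.
  obtain ⟨u, P, Q, η, hu, hη, hη0, hsup, hhol⟩ := exists_isStaircase_holder hΩ b
    (S := activeClass p s ρ A) (T := doneClass p s ρ) rfl
    (stepRule_activeClass hp1 hp2 hs0 hs1 h10 h11 h20 h21 h1 h2 hρ1 hA0 hA1) hα1
    (show 0 < δ / 4 by positivity)
  have hvol : volume Ω ≠ ⊤ := hΩ.isBounded.measure_lt_top.ne
  have hvol0 : volume Ω ≠ 0 := (hΩ.isOpen.measure_pos _ hΩ.isConnected.nonempty).ne'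
  have hκ := activeWeight_nonneg h10 h20
  have hnull := hu.ae_mem_done hκ hvol (tendsto_prod_activeWeight h10 h11 h20 h21)
  have hcont := hu.continuous_limitMap hη
  have hS : ∀ n, ∀ C ∈ activeClass p s ρ A n, ‖C‖ ≤ gradBound ρ n := fun n C hC =>
    norm_le_gradBound_of_mem_activeClass hp1 hp2 hs0 hs1 hρ1 hA0 hA1 hC
  have hT : ∀ n, ∀ C ∈ doneClass p s ρ n, ‖C‖ ≤ gradBound ρ n := fun n C hC =>
    norm_le_gradBound_of_mem_doneClass hp1 hp2 hs1 hρ1 hC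
  have hfin : ∀ r : ℝ, 0 ≤ r → r < q → ∑' n, (gradBound ρ n : ℝ≥0∞) ^ r * volume (⋃₀ P n) ≠ ⊤ := by
    intro r hr0 hr
    simp only [hu.volume_active hκ]
    refine tsum_gradBound_rpow_ne_top h10 h11 h20 h21 (by linarith) hr0 ?_ hvol
    rw [hβq, ← Real.rpow_add two_pos]
    exact Real.rpow_lt_one_of_one_lt_of_neg one_lt_two (by linarith)
  have hgrad : IsWeakGradient Ω (limitMap u) (jacobian (limitMap u)) :=
    hu.isWeakGradient_limitMap hη hη0 hS hT hnull (by simpa using hfin 1 zero_le_one hq1)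
  have hW : ∀ r : ℝ, 1 ≤ r → r < q → MemW1 (ENNReal.ofReal r) Ω (limitMap u) := fun r hr1 hr =>
    ⟨memLp_of_continuous hΩ.isBounded hcont _, _, hgrad,
      hu.memLp_jacobian hη hT hnull (by linarith) (hfin r (by linarith) hr)⟩
  have hW1 : MemW1 1 Ω (limitMap u) := by simpa using hW 1 le_rfl hq1
  have hK : ∀ᵐ x ∂volume.restrict Ω, jacobian (limitMap u) x ∈ K p := by
    filter_upwards [hu.ae_restrict_mem_done hnull] with x hx
    obtain ⟨n, hn⟩ := mem_iUnion.1 hx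
    exact doneClass_subset_K (hu.jacobian_limitMap_mem hη hn)
  have hint : ∀ i j, IntegrableOn (fun x => jacobian (limitMap u) x i j) Ω := by
    have hG := hu.memLp_jacobian hη hT hnull one_pos (hfin 1 zero_le_one hq1)
    rw [ENNReal.ofReal_one] at hG
    exact fun i j => memLp_one_iff_integrable.1 (hG.mono
      (measurable_jacobian hcont i j).aestronglyMeasurable (.of_forall fun x => abs_apply_le_norm _ i j))
  have hrow := lintegral_row_eq_top h10 h20 h21 (by linarith) (q := q)
    (by rw [hβq, ← Real.rpow_add two_pos, add_neg_cancel, Real.rpow_zero]) (by linarith) hu hη hvol hvol0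
  obtain ⟨La, hLa⟩ := lipschitzWith_affineMap A b
  refine ⟨limitMap u, jacobian (limitMap u), hu.isPiecewiseAffine_limitMap hη hnull, hW1, hgrad, ?_, ?_, ?_,
    hK, ?_, hW, ?_, isVeryWeakPLaplaceSolution_of_mem_K hp1 hgrad hint hK, hrow⟩
  · exact holderNormOn_lt_top hα1 hΩ.isBounded.closure hLa (by positivity) hsup hhol
  · intro x hx
    exact hu.limitMap_eq_of_notMem hη fun h => hx.2 (by rwa [hΩ.isOpen.interior_eq])
  · refine (holderNormOn_le (by positivity) (fun x _ => hsup x) fun x _ y _ => hhol x y).trans_lt ?_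
    rw [← ENNReal.ofReal_add (by positivity) (by positivity)]
    exact (ENNReal.ofReal_lt_ofReal_iff hδ).2 (by linarith)
  · have hvr : 0 < volume.real Ω := ENNReal.toReal_pos hvol0 hvol
    intro t ht
    refine tail_bounds hp1 hp2 hs0 hs1 (by linarith) (norm_nonneg A) hc hβq hρ
      (fun t => volume.real {x | x ∈ Ω ∧ t < ‖jacobian (limitMap u) x‖} / volume.real Ω)
      (fun t => ?_) (fun m t hm => ?_) (fun m t hm => ?_) ht
    · exact div_le_one_of_le₀ (measureReal_mono (fun x hx => hx.1) hvol) hvr.le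
    · rw [div_le_iff₀ hvr]
      exact volume_real_tail_le hp1 hp2 hs1 hρ1 h10 h20 hu hη hvol hnull hm
    · rw [le_div_iff₀ hvr]
      exact le_volume_real_tail h10 h20 h21 hu hη hvol hm
  · refine top_unique (hrow.symm.le.trans (lintegral_mono fun x => ?_))
    have hle : ‖row (jacobian (limitMap u) x) 0‖ₑ ≤ ‖jacobian (limitMap u) x‖ₑ := by
      rw [← ofReal_norm, ← ofReal_norm]
      exact ENNReal.ofReal_le_ofReal (norm_row_le _ _)
    have hq0 : 0 ≤ q := by linarith
    gcongr
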